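/- Let $0<a_i<b_i$ ($i=1,2$), $\Omega=(a_1,b_1)\times(a_2,b_2)\subset\mathbb{R}^2$, $Y=(0,1)^2$, and for $h=1,2,3,\dots$ let $\alpha^h:\mathbb{R}^2\to\mathbb{R}^2$, $\alpha^h(x)=(hx_1,\,hx_2|x_2|)$. Put $\zeta(x)=(\zeta_1(x),\zeta_2(x))=(1,2x_2)$. Let $C_{\mathrm{per}}(Y)$ be the space of continuous $Y$-periodic functions on $\mathbb{R}^2$ with the supremum norm, $X=L^2(\Omega;C_{\mathrm{per}}(Y))$, and let $\mathcal{D}=\mathcal{D}(\Omega;C^\infty_{\mathrm{per}}(Y))$ be the space of smooth functions $\varphi(x,y)$ that are $Y$-periodic in $y$ and vanish for $x$ outside a compact subset of $\Omega$. Then $\{\alpha^h\}$ is of type $\mathrm{H}^\zeta_{X}$; that is, each $\alpha^h$ is a continuous bijection of $\mathbb{R}^2$, differentiable in $\Omega$, and the following hold. (i) $X$ is a Banach space with $\mathcal{D}\subset X\subset L^2(\Omega;L^2_{\mathrm{per}}(Y))=L^2(\Omega\times Y)$, and the linear operators $\tau^h:X\to L^2(\Omega)$, $\tau^hv=v(\cdot,\alpha^h(\cdot))$,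 are strongly two-scale compatible with respect to $X$, i.e.: there is $C>0$ such that for every $v\in X$ the limit $\lim_{h\to\infty}\|\tau^hv\|_{L^2(\Omega)}$ exists and is at most $C\|v\|_{L^2(\Omega\times Y)}$, and $\|\tau^hv\|_{L^2(\Omega)}\le C\|v\|_X$ for all $h$; for every $v\in X$, $\tau^hv\rightharpoonup\int_Yv(\cdot,y)\,dy$ weakly in $L^2(\Omega)$; and whenever $\{u^h\}$ is bounded in $L^2(\Omega)$ and $u_0\in L^2(\Omega\times Y)$ satisfies $\int_\Omega u^h\,\tau^hv\,dx\to\int_\Omega\int_Yu_0v\,dy\,dx$ for all $v\in X$, then $u^h\rightharpoonup\int_Yu_0(\cdot,y)\,dy$ weakly in $L^2(\Omega)$. (ii) $\zeta\in L^\infty(\Omega)^2$ and there is a sequence $p^h\to0$ strongly in $H^1(\Omega)$ with $p^h\,\bigl(\partial\alpha^h_j/\partial x_i\bigr)_{i,j}\to\mathrm{diag}(\zeta_1,\zeta_2)$ in $L^2(\Omega)^{2\times2}$. (iii) There is a Banach space $Z\subset X^2$ such that $Z\cap\mathcal{D}^2$ is dense in $Z$ and, for all $v\in Z\cap\mathcal{D}^2$,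 $$\sum_{i,j=1}^2\frac{\partial v_i}{\partial y_j}\bigl(\cdot,\alpha^h(\cdot)\bigr)\,\frac{\partial\alpha^h_j}{\partial x_i}\rightharpoonup0\quad\text{weakly in }L^2(\Omega).$$ More precisely, in (ii) one may take the constant functions $p^h=1/h$, and in (iii) one may take $$Z=\Bigl\{v\in X^2:\ \sum_{i=1}^2\zeta_i\frac{\partial v_i}{\partial y_i}=0\Bigr\}$$ with the norm of $X^2$, where the $y$-derivatives are weak derivatives of periodic functions: for a.e. $x\in\Omega$, $\sum_i\zeta_i(x)\int_Yv_i(x,y)\,\partial_{y_i}\psi(y)\,dy=0$ for all smooth $Y$-periodic $\psi$. The same three properties (completeness, density of the elements of $\mathcal{D}^2$, and the weak convergence for them) also hold for the space $\{v\in L^2(\Omega;L^2_{\mathrm{per}}(Y)^2):\sum_i\zeta_i\,\partial v_i/\partial y_i=0\}$ with the $L^2(\Omega\times Y)^2$ norm. -/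

import Mathlib

open MeasureTheory Filter Topology Set
open scoped ENNReal ContDiff BoundedContinuousFunction

noncomputable section

namespace LambdaScale

/-- `ℝ^N`. Only its topology, linear structure and Lebesgue measure are used. -/
abbrev Vec (N : ℕ) : Type := Fin N → ℝ

/-- The unit cube `Y = (0,1)^N`. -/
def unitCube (N : ℕ) : Set (Vec N) := Set.univ.pi fun _ => Set.Ioo (0 : ℝ) 1

/-- Lebesgue measure on `Ω`. -/
abbrev volOn {N : ℕ} (Ω : Set (Vec N)) : Measure (Vec N) := volume.restrict Ω

/-- Lebesgue measure on `Ω × Y`. -/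
abbrev volProd {N : ℕ} (Ω : Set (Vec N)) : Measure (Vec N × Vec N) :=
  (volOn Ω).prod (volOn (unitCube N))

/-- `L²(Ω)`. -/
abbrev L2 {N : ℕ} (Ω : Set (Vec N)) : Type := Lp ℝ 2 (volOn Ω)

/-- `L²(Ω × Y)`, which is also `L²(Ω; L²_per(Y))`: a function on the cell `Y` is identified with
its periodic extension. -/
abbrev L2Y {N : ℕ} (Ω : Set (Vec N)) : Type := Lp ℝ 2 (volProd Ω)

/-- `Y`-periodicity of a function on `ℝ^N`. -/
def IsYPeriodic {N : ℕ} (f : Vec N → ℝ) : Prop :=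
  ∀ (k : Fin N → ℤ) (y : Vec N), f (y + fun i => (k i : ℝ)) = f y

/-- Linear subspaces of a normed space. -/
abbrev NormedSubspace (E : Type) [NormedAddCommGroup E] [NormedSpace ℝ E] : Type := Submodule ℝ E

/-- `C_per(Y)`: continuous `Y`-periodic functions on `ℝ^N`, with the supremum norm. -/
def Cper (N : ℕ) : NormedSubspace (Vec N →ᵇ ℝ) where
  carrier := {f | IsYPeriodic f}
  add_mem' := by
    intro f g hf hg k y
    simp only [BoundedContinuousFunction.coe_add, Pi.add_apply]
    rw [hf k y, hg k y]
  zero_mem' := by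
    intro k y
    simp
  smul_mem' := by
    intro c f hf k y
    simp only [BoundedContinuousFunction.coe_smul]
    rw [hf k y]

/-- `X = L²(Ω; C_per(Y))` (Bochner). -/
abbrev L2Cper {N : ℕ} (Ω : Set (Vec N)) : Type := Lp (Cper N) 2 (volOn Ω)

theorem continuous_eval_Cper {N : ℕ} :
    Continuous fun p : Cper N × Vec N => (p.1 : Vec N →ᵇ ℝ) p.2 :=
  continuous_eval.comp
    ((continuous_subtype_val.comp continuous_fst).prodMk continuous_snd)

theorem abs_eval_le {N : ℕ} (f : Cper N) (y : Vec N) : ‖(f : Vec N →ᵇ ℝ) y‖ ≤ ‖f‖ :=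
  (f : Vec N →ᵇ ℝ).norm_coe_le_norm y

theorem memLp_comp {N : ℕ} {Ω : Set (Vec N)} (β : C(Vec N, Vec N)) (v : L2Cper Ω) :
    MemLp (fun x => (v x : Vec N →ᵇ ℝ) (β x)) 2 (volOn Ω) := by
  refine MemLp.of_le (Lp.memLp v) ?_ (ae_of_all _ fun x => abs_eval_le (v x) (β x))
  exact continuous_eval_Cper.comp_aestronglyMeasurable
    ((Lp.aestronglyMeasurable v).prodMk β.continuous.aestronglyMeasurable)

instance {N : ℕ} : IsFiniteMeasure (volOn (unitCube N)) := by
  refine ⟨?_⟩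
  rw [Measure.restrict_apply_univ, unitCube, Real.volume_pi_Ioo]
  simp

theorem memLp_uncurry {N : ℕ} {Ω : Set (Vec N)} (v : L2Cper Ω) :
    MemLp (fun p : Vec N × Vec N => (v p.1 : Vec N →ᵇ ℝ) p.2) 2 (volProd Ω) := by
  have h1 : MemLp (fun p : Vec N × Vec N => v p.1) 2 (volProd Ω) :=
    (Lp.memLp v).comp_fst (volOn (unitCube N))
  refine MemLp.of_le h1 ?_ (ae_of_all _ fun p => abs_eval_le (v p.1) p.2)
  exact continuous_eval_Cper.comp_aestronglyMeasurable
    (h1.1.prodMk continuous_snd.aestronglyMeasurable)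

/-- `τ v = v(·, β(·))` as a linear operator `L²(Ω; C_per(Y)) → L²(Ω)`. -/
def tau {N : ℕ} (Ω : Set (Vec N)) (β : C(Vec N, Vec N)) : L2Cper Ω →ₗ[ℝ] L2 Ω where
  toFun v := (memLp_comp β v).toLp
  map_add' v w := by
    rw [← MemLp.toLp_add]
    refine MemLp.toLp_congr _ _ ?_
    filter_upwards [Lp.coeFn_add v w] with x hx
    rw [hx]; rfl
  map_smul' c v := by
    rw [RingHom.id_apply, ← MemLp.toLp_const_smul]
    refine MemLp.toLp_congr _ _ ?_
    filter_upwards [Lp.coeFn_smul c v] with x hx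
    rw [hx]; rfl

/-- The inclusion `L²(Ω; C_per(Y)) ⊂ L²(Ω × Y)`: `v` is viewed as `(x,y) ↦ v(x,y)`. -/
def toL2Y {N : ℕ} (Ω : Set (Vec N)) : L2Cper Ω →ₗ[ℝ] L2Y Ω where
  toFun v := (memLp_uncurry v).toLp
  map_add' v w := by
    rw [← MemLp.toLp_add]
    refine MemLp.toLp_congr _ _ ?_
    filter_upwards [Measure.quasiMeasurePreserving_fst.ae (Lp.coeFn_add v w)] with p hp
    dsimp only [Pi.add_apply, Pi.smul_apply]; rw [hp]; rfl
  map_smul' c v := by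
    rw [RingHom.id_apply, ← MemLp.toLp_const_smul]
    refine MemLp.toLp_congr _ _ ?_
    filter_upwards [Measure.quasiMeasurePreserving_fst.ae (Lp.coeFn_smul c v)] with p hp
    dsimp only [Pi.add_apply, Pi.smul_apply]; rw [hp]; rfl

/-- `f^h ⇀ f` weakly in `L²(Ω)`. -/
def WeakTendsto {N : ℕ} (Ω : Set (Vec N)) (f : ℕ+ → Vec N → ℝ) (f₀ : Vec N → ℝ) : Prop :=
  (∀ h, MemLp (f h) 2 (volOn Ω)) ∧ MemLp f₀ 2 (volOn Ω) ∧
    ∀ g : Vec N → ℝ, MemLp g 2 (volOn Ω) →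
      Tendsto (fun h => ∫ x in Ω, f h x * g x) atTop (𝓝 (∫ x in Ω, f₀ x * g x))

/-- `f^h → f` strongly in `L²(Ω)`. -/
def StrongTendsto {N : ℕ} (Ω : Set (Vec N)) (f : ℕ+ → Vec N → ℝ) (f₀ : Vec N → ℝ) : Prop :=
  (∀ h, MemLp (f h) 2 (volOn Ω)) ∧ MemLp f₀ 2 (volOn Ω) ∧
    Tendsto (fun h => eLpNorm (fun x => f h x - f₀ x) 2 (volOn Ω)) atTop (𝓝 0)

section Compatibility

variable {N : ℕ} (Ω : Set (Vec N)) {X : Type} [NormedAddCommGroup X] [NormedSpace ℝ X]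

/-- Two-scale convergence of `u^h` to `u₀` with respect to `τ^h : X → L²(Ω)`, where
`j : X → L²(Ω × Y)` is the inclusion. -/
def TwoScaleConverges (j : X →ₗ[ℝ] L2Y Ω) (τ : ℕ+ → X →ₗ[ℝ] L2 Ω) (u : ℕ+ → L2 Ω)
    (u₀ : L2Y Ω) : Prop :=
  ∀ v : X, Tendsto (fun h => ∫ x in Ω, u h x * τ h v x) atTop
    (𝓝 (∫ p, u₀ p * j v p ∂(volProd Ω)))

/-- Two-scale compatibility of `τ^h` with respect to `X`. -/
def IsTwoScaleCompatible (j : X →ₗ[ℝ] L2Y Ω) (τ : ℕ+ → X →ₗ[ℝ] L2 Ω) : Prop :=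
  ∃ C : ℝ, 0 < C ∧ ∀ v : X,
    (∃ l : ℝ, Tendsto (fun h => ‖τ h v‖) atTop (𝓝 l) ∧ l ≤ C * ‖j v‖) ∧
    ∀ h, ‖τ h v‖ ≤ C * ‖v‖

/-- Strong two-scale compatibility of `τ^h` with respect to `X`. -/
def IsStronglyTwoScaleCompatible (j : X →ₗ[ℝ] L2Y Ω) (τ : ℕ+ → X →ₗ[ℝ] L2 Ω) : Prop :=
  IsTwoScaleCompatible Ω j τ ∧
  (∀ (u : ℕ+ → L2 Ω) (u₀ : L2Y Ω), (∃ K : ℝ, ∀ h, ‖u h‖ ≤ K) →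
    TwoScaleConverges Ω j τ u u₀ →
    WeakTendsto Ω (fun h => u h) fun x => ∫ y in unitCube N, u₀ (x, y)) ∧
  ∀ v : X, WeakTendsto Ω (fun h => τ h v) fun x => ∫ y in unitCube N, j v (x, y)

end Compatibility

/-- Partial derivative `∂f/∂x_i` at `x`. -/
def partialD {N : ℕ} (i : Fin N) (f : Vec N → ℝ) (x : Vec N) : ℝ := fderiv ℝ f x (Pi.single i 1)

/-- `D(Ω; C^∞_per(Y))`: smooth functions `φ(x,y)`, `Y`-periodic in `y`, supported in `x` in a
compact subset of `Ω`. -/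
def IsTest {N : ℕ} (Ω : Set (Vec N)) (φ : Vec N → Vec N → ℝ) : Prop :=
  ContDiff ℝ ∞ (fun p : Vec N × Vec N => φ p.1 p.2) ∧ (∀ x, IsYPeriodic (φ x)) ∧
    ∃ K : Set (Vec N), IsCompact K ∧ K ⊆ Ω ∧ ∀ x, x ∉ K → ∀ y, φ x y = 0

/-- `q` is the weak partial derivative `∂p/∂x_i` in `Ω`. -/
def IsWeakPartial {N : ℕ} (Ω : Set (Vec N)) (i : Fin N) (p q : Vec N → ℝ) : Prop :=
  ∀ φ : Vec N → ℝ, ContDiff ℝ ∞ φ → HasCompactSupport φ → tsupport φ ⊆ Ω →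
    ∫ x in Ω, p x * partialD i φ x = -∫ x in Ω, q x * φ x

/-- `p^h → 0` strongly in `H¹(Ω)`: `p^h` and its weak partial derivatives are in `L²(Ω)` and tend
to zero there. -/
def TendstoZeroH1 {N : ℕ} (Ω : Set (Vec N)) (p : ℕ+ → Vec N → ℝ) : Prop :=
  StrongTendsto Ω p 0 ∧
    ∃ q : Fin N → ℕ+ → Vec N → ℝ,
      (∀ i h, IsWeakPartial Ω i (p h) (q i h)) ∧ ∀ i, StrongTendsto Ω (q i) 0

/-- `p^h → 0` in `H¹(Ω)` and `p^h (∂α^h_j/∂x_i)_{ij} → diag(ζ)` in `L²(Ω)^{N×N}`, with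
`ζ ∈ L^∞(Ω)^N`. -/
def GradientCondition {N : ℕ} (Ω : Set (Vec N)) (α : ℕ+ → C(Vec N, Vec N))
    (ζ : Fin N → Vec N → ℝ) (p : ℕ+ → Vec N → ℝ) : Prop :=
  TendstoZeroH1 Ω p ∧ (∀ i, MemLp (ζ i) ∞ (volOn Ω)) ∧
    ∀ i j, StrongTendsto Ω (fun h x => p h x * partialD i (fun x' => α h x' j) x)
      (fun x => Matrix.diagonal (fun k => ζ k x) i j)

/-- The elements of `E^N` that belong to `D(Ω; C^∞_per(Y)^N)`, where `j : E → L²(Ω × Y)` is the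
inclusion of a function space `E`. -/
def smoothElements {N : ℕ} (Ω : Set (Vec N)) {E : Type} [NormedAddCommGroup E] [NormedSpace ℝ E]
    (j : E →ₗ[ℝ] L2Y Ω) : Set (Fin N → E) :=
  {v | ∃ φ : Fin N → Vec N → Vec N → ℝ, ∀ i, IsTest Ω (φ i) ∧
    j (v i) =ᵐ[volProd Ω] fun p => φ i p.1 p.2}

/-- `Z ⊂ E^N` is a Banach space in which `Z ∩ D(Ω; C^∞_per(Y)^N)` is dense, and
`∑_{i,j} ∂v_i/∂y_j(·, α^h(·)) ∂α^h_j/∂x_i ⇀ 0` in `L²(Ω)` for all `v` in this intersection. -/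
def DensityCondition {N : ℕ} (Ω : Set (Vec N)) (α : ℕ+ → C(Vec N, Vec N))
    {E : Type} [NormedAddCommGroup E] [NormedSpace ℝ E] (j : E →ₗ[ℝ] L2Y Ω)
    (Z : Submodule ℝ (Fin N → E)) : Prop :=
  IsComplete (Z : Set (Fin N → E)) ∧
  (Z : Set (Fin N → E)) ⊆ closure ((Z : Set (Fin N → E)) ∩ smoothElements Ω j) ∧
  ∀ v ∈ Z, ∀ φ : Fin N → Vec N → Vec N → ℝ,
    (∀ i, IsTest Ω (φ i) ∧ j (v i) =ᵐ[volProd Ω] fun p => φ i p.1 p.2) →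
    WeakTendsto Ω
      (fun h x => ∑ i, ∑ k, partialD k (φ i x) (α h x) * partialD i (fun x' => α h x' k) x) 0

/-- `{α^h}` is of type `H^ζ_X` with `X = L²(Ω; C_per(Y))`. -/
structure IsTypeH {N : ℕ} (Ω : Set (Vec N)) (α : ℕ+ → C(Vec N, Vec N))
    (ζ : Fin N → Vec N → ℝ) : Prop where
  bijective : ∀ h, Function.Bijective (α h)
  differentiable : ∀ h, ∀ x ∈ Ω, DifferentiableAt ℝ (α h) x
  /-- `X` is a Banach space -/
  complete : CompleteSpace (L2Cper Ω)
  /-- `D(Ω; C^∞_per(Y)) ⊂ X` -/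
  test_subset : ∀ φ, IsTest Ω φ →
    ∃ v : L2Cper Ω, toL2Y Ω v =ᵐ[volProd Ω] fun p => φ p.1 p.2
  /-- `X ⊂ L²(Ω; L²_per(Y))` -/
  subset_L2 : Function.Injective (toL2Y Ω)
  compatible : IsStronglyTwoScaleCompatible Ω (toL2Y Ω) fun h => tau Ω (α h)
  gradient : ∃ p, GradientCondition Ω α ζ p
  density : ∃ Z : Submodule ℝ (Fin N → L2Cper Ω), DensityCondition Ω α (toL2Y Ω) Z

theorem ae_memLp_section {N : ℕ} {Ω : Set (Vec N)} (v : L2Y Ω) :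
    ∀ᵐ x ∂(volOn Ω), MemLp (fun y => v (x, y)) 2 (volOn (unitCube N)) := by
  have hv := Lp.memLp v
  filter_upwards [hv.integrable_sq.prod_right_ae, hv.1.prodMk_left] with x hx hm
  exact (memLp_two_iff_integrable_sq hm).2 hx

theorem memLp_partialD {N : ℕ} (i : Fin N) {ψ : Vec N → ℝ} (hψ : ContDiff ℝ ∞ ψ) :
    MemLp (partialD i ψ) 2 (volOn (unitCube N)) := by
  have hc : Continuous (partialD i ψ) := (hψ.continuous_fderiv (by simp)).clm_apply continuous_const
  obtain ⟨C, hC⟩ := (isCompact_univ_pi fun _ : Fin N =>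
    isCompact_Icc (a := (0 : ℝ)) (b := 1)).exists_bound_of_continuousOn hc.continuousOn
  refine MemLp.of_bound hc.aestronglyMeasurable C ?_
  exact (ae_restrict_iff' (MeasurableSet.univ_pi fun _ => measurableSet_Ioo)).2
    (ae_of_all _ fun y hy => hC y fun i hi => Ioo_subset_Icc_self (hy i hi))

/-- `Z = {v ∈ L²(Ω; L²_per(Y)^N) : ∑ ζ_i ∂v_i/∂y_i = 0}`. The derivatives are weak derivatives of
periodic functions, so for almost every `x` the relation is tested against all smooth periodic
functions `ψ` on the cell. -/
def divFreeL2 {N : ℕ} (Ω : Set (Vec N)) (ζ : Fin N → Vec N → ℝ) :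
    Submodule ℝ (Fin N → L2Y Ω) where
  carrier := {v | ∀ᵐ x ∂(volOn Ω), ∀ ψ : Vec N → ℝ, ContDiff ℝ ∞ ψ → IsYPeriodic ψ →
    ∑ i, ζ i x * ∫ y in unitCube N, v i (x, y) * partialD i ψ y = 0}
  add_mem' := by
    intro v w hv hw
    have hadd : ∀ i, ∀ᵐ x ∂(volOn Ω), ∀ᵐ y ∂(volOn (unitCube N)),
        (v + w) i (x, y) = v i (x, y) + w i (x, y) := fun i =>
      Measure.ae_ae_of_ae_prod (Lp.coeFn_add (v i) (w i))
    filter_upwards [hv, hw, ae_all_iff.2 hadd, ae_all_iff.2 fun i => ae_memLp_section (v i),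
      ae_all_iff.2 fun i => ae_memLp_section (w i)] with x h1 h2 h3 h4 h5 ψ hψ hψp
    rw [← add_zero (0 : ℝ)]
    nth_rewrite 1 [← h1 ψ hψ hψp]
    rw [← h2 ψ hψ hψp, ← Finset.sum_add_distrib]
    refine Finset.sum_congr rfl fun i _ => ?_
    have hd := memLp_partialD i hψ
    have hsum := integral_add ((h4 i).integrable_mul hd) ((h5 i).integrable_mul hd)
    simp only [Pi.mul_apply] at hsum
    rw [← mul_add, ← hsum]
    refine congrArg (ζ i x * ·) (integral_congr_ae ?_)
    filter_upwards [h3 i] with y hy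
    rw [hy, add_mul]
  zero_mem' := by
    have h0 : ∀ᵐ x ∂(volOn Ω), ∀ᵐ y ∂(volOn (unitCube N)), (0 : L2Y Ω) (x, y) = 0 :=
      Measure.ae_ae_of_ae_prod (Lp.coeFn_zero ℝ 2 (volProd Ω))
    filter_upwards [h0] with x hx ψ _ _
    refine Finset.sum_eq_zero fun i _ => ?_
    rw [integral_eq_zero_of_ae, mul_zero]
    filter_upwards [hx] with y hy
    have hy' : (0 : Fin N → L2Y Ω) i (x, y) = 0 := hy
    rw [hy', zero_mul]
    rfl
  smul_mem' := by
    intro c v hv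
    have hs : ∀ i, ∀ᵐ x ∂(volOn Ω), ∀ᵐ y ∂(volOn (unitCube N)),
        (c • v) i (x, y) = c * v i (x, y) := fun i =>
      Measure.ae_ae_of_ae_prod (Lp.coeFn_smul c (v i))
    filter_upwards [hv, ae_all_iff.2 hs] with x h1 h2 ψ hψ hψp
    rw [← mul_zero c, ← h1 ψ hψ hψp, Finset.mul_sum]
    refine Finset.sum_congr rfl fun i _ => ?_
    rw [mul_left_comm, ← integral_const_mul c]
    refine congrArg (ζ i x * ·) (integral_congr_ae ?_)
    filter_upwards [h2 i] with y hy
    rw [hy, mul_assoc]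

/-- `Z` as a subspace of `X^N = L²(Ω; C_per(Y))^N`, with the norm of `X^N`. -/
def divFree {N : ℕ} (Ω : Set (Vec N)) (ζ : Fin N → Vec N → ℝ) :
    Submodule ℝ (Fin N → L2Cper Ω) :=
  (divFreeL2 Ω ζ).comap ((toL2Y Ω).compLeft (Fin N))

/-- `α^h(x) = (h x₁, h x₂ |x₂|)`. -/
def alphaEx (h : ℕ+) : C(Vec 2, Vec 2) where
  toFun x := ![(h : ℝ) * x 0, (h : ℝ) * (x 1 * |x 1|)]
  continuous_toFun := by
    refine continuous_pi fun i => ?_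
    fin_cases i <;> simp <;> fun_prop

/-- `ζ = (1, 2 x₂)`. -/
def zetaEx : Fin 2 → Vec 2 → ℝ := ![fun _ => 1, fun x => 2 * x 1]

/-- `Ω = (a₁,b₁) × (a₂,b₂)`. -/
def box (a b : Vec 2) : Set (Vec 2) := Set.univ.pi fun i => Set.Ioo (a i) (b i)

end LambdaScale

end

noncomputable section

namespace LambdaScale

/-! On `Ω` the second coordinate is positive, so `α^h = h f` with `f(x) = (x₁, x₂²)`: there `f` is
injective with Jacobian matrix `diag(ζ)` and determinant `2x₂ ≠ 0`.

Compatibility rests on one limit, `tendsto_integral_comp_alphaEx`: `∫_Ω F(x)(α^h(x)) dx → ∫_Ω ∫_Y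
F(x)(t) dt dx` for `F ∈ L¹(Ω; C_per(Y))`. The substitution `z = f(x)` reduces it to
`tendsto_integral_scale`, the case of the phase `hz`. There a shift of the phase by `t ∈ Y` amounts
to a shift of `z` by `t/h`, which is negligible by continuity of translations in `L¹`, while the
average over all `t ∈ Y` is exactly the limit. Taking `F = v²` gives convergence of norms and `F = g
v` gives weak convergence.

Since the Jacobian matrix of `α^h` is `h diag(ζ)`, the factor `1/h` gives `diag(ζ)` exactly. For
smooth `v` the sum in (iii) is `h ∑ ζ_i ∂v_i/∂y_i` evaluated at `y = α^h(x)`, hence zero for almost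
every `x`, because a smooth field that is weakly divergence free is classically so
(`IsDivFree.sum_partialD_eq_zero`).

Completeness is closedness of the constraint (`isClosed_divFreeL2`). For density, multiplication of
the components by `ζ_i`, which is bounded with bounded smooth inverse on `Ω`, reduces to `ζ =
(1,…,1)`. Then the space inside `X^N` consists of the `L²` maps into the fixed space `divFreeCper
N`; simple functions are dense, and `1_s c` is approximated by `θ(x) d(y)` with `θ` a smooth cutoff
and `d` a mollification of `c` (`divFree_one_subset_closure`). In `L²(Ω × Y)^N` the continuous
fields are shown dense by orthogonality: a divergence free `r` orthogonal to them has zero average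
over every measurable set of `x`, since convolving such an average `e` with a kernel and then with
the reflected kernel yields an admissible test field whose pairing with `e` is a sum of squares
(`ae_eq_zero_of_divFree_of_orthogonal`). -/

/-! ### Periodic functions and integration over the cell. -/

theorem measurableSet_unitCube {N : ℕ} : MeasurableSet (unitCube N) :=
  MeasurableSet.univ_pi fun _ => measurableSet_Ioo

theorem isOpen_unitCube {N : ℕ} : IsOpen (unitCube N) :=
  isOpen_set_pi finite_univ fun _ _ => isOpen_Ioo

instance {N : ℕ} : IsProbabilityMeasure (volOn (unitCube N)) := by
  refine ⟨?_⟩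
  rw [Measure.restrict_apply_univ, unitCube, Real.volume_pi_Ioo]
  simp

theorem integral_cell_const {N : ℕ} (c : ℝ) : ∫ _ in unitCube N, c = c := by
  simp

theorem fundamentalDomain_ae_eq_unitCube {N : ℕ} :
    ZSpan.fundamentalDomain (Pi.basisFun ℝ (Fin N)) =ᵐ[volume] unitCube N := by
  rw [ZSpan.fundamentalDomain_pi_basisFun, unitCube, volume_pi]
  exact Measure.univ_pi_Ico_ae_eq_Icc.trans Measure.univ_pi_Ioo_ae_eq_Icc.symm

/-- Up to a null set the cell is a fundamental domain of the lattice `ℤ^N`, and so is each of its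
translates; a lattice-invariant function has the same integral over both. -/
theorem setIntegral_unitCube_add {N : ℕ} {f : Vec N → ℝ} (hf : IsYPeriodic f) (t : Vec N) :
    ∫ y in unitCube N, f (y + t) = ∫ y in unitCube N, f y := by
  set b := Pi.basisFun ℝ (Fin N)
  have hD := ZSpan.isAddFundamentalDomain' b (volume : Measure (Vec N))
  have hper : ∀ (g : (Submodule.span ℤ (Set.range b)).toAddSubgroup) (x : Vec N), f (g +ᵥ x) = f x := by
    intro g x
    obtain ⟨k, hk⟩ : ∃ k : Fin N → ℤ, (g : Vec N) = fun i => (k i : ℝ) := by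
      refine ⟨fun i => ⌊(g : Vec N) i⌋, ?_⟩
      have := ZSpan.floor_eq_self_of_mem b g.1 g.2
      ext i
      have h := ZSpan.repr_floor_apply b g.1 i
      have h1 : (ZSpan.floor b g.1 : Vec N) i = (⌊(g : Vec N) i⌋ : ℝ) := by
        simpa [b] using h
      rw [← h1, this]
    have : g +ᵥ x = x + fun i => (k i : ℝ) := by
      rw [← hk, add_comm]; rfl
    rw [this, hf]
  have : Countable (Submodule.span ℤ (Set.range b)).toAddSubgroup :=
    inferInstanceAs (Countable (Submodule.span ℤ (Set.range b)))
  have h1 := hD.setIntegral_eq (hD.vadd_of_comm t) hper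
  rw [setIntegral_congr_set fundamentalDomain_ae_eq_unitCube] at h1
  rw [h1]
  have h2 := (measurePreserving_vadd t (volume : Measure (Vec N))).setIntegral_image_emb
    (measurableEmbedding_const_vadd t) f (ZSpan.fundamentalDomain b)
  rw [← setIntegral_congr_set (f := fun y => f (y + t)) fundamentalDomain_ae_eq_unitCube]
  change _ = ∫ x in (fun x => t +ᵥ x) '' _, f x
  rw [h2]
  simp only [vadd_eq_add, add_comm t, b]

theorem IsYPeriodic.comp_add {N : ℕ} {f : Vec N → ℝ} (hf : IsYPeriodic f) (t : Vec N) :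
    IsYPeriodic fun y => f (y + t) := by
  intro k y
  refine Eq.trans ?_ (hf k (y + t))
  change f _ = f _
  congr 1
  abel

theorem IsYPeriodic.comp_neg {N : ℕ} {f : Vec N → ℝ} (hf : IsYPeriodic f) :
    IsYPeriodic fun y => f (-y) := by
  intro k y
  refine Eq.trans ?_ (hf (-k) (-y))
  change f _ = f _
  congr 1
  ext i
  simp
  ring

theorem IsYPeriodic.mul {N : ℕ} {f g : Vec N → ℝ} (hf : IsYPeriodic f) (hg : IsYPeriodic g) :
    IsYPeriodic fun y => f y * g y := fun k y => by
  simp only [hf k y, hg k y]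

theorem IsYPeriodic.partialD {N : ℕ} {f : Vec N → ℝ} (hf : IsYPeriodic f) (i : Fin N) :
    IsYPeriodic (partialD i f) := by
  intro k y
  unfold LambdaScale.partialD
  have h : (fun x => f (x + fun i => (k i : ℝ))) = f := funext (hf k)
  rw [← fderiv_comp_add_right, h]

theorem _root_.ContDiff.partialD {N : ℕ} {f : Vec N → ℝ} (hf : ContDiff ℝ ∞ f) (i : Fin N) :
    ContDiff ℝ ∞ (partialD i f) :=
  (hf.fderiv_right (m := ∞) (by simp)).clm_apply contDiff_const

theorem IsYPeriodic.exists_cell {N : ℕ} {f : Vec N → ℝ} (hf : IsYPeriodic f) (y : Vec N) :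
    ∃ z ∈ Set.Icc (0 : Vec N) 1, f y = f z := by
  refine ⟨fun i => Int.fract (y i), ⟨fun i => Int.fract_nonneg _, fun i => (Int.fract_lt_one _).le⟩,
    ?_⟩
  rw [← hf (fun i => ⌊y i⌋) (fun i => Int.fract (y i))]
  congr 1
  ext i
  simp [Int.fract_add_floor]

theorem closure_unitCube {N : ℕ} : closure (unitCube N) = Set.Icc (0 : Vec N) 1 := by
  rw [unitCube, closure_pi_set]
  simp only [closure_Ioo (zero_ne_one' ℝ), ← Set.pi_univ_Icc]
  rfl

theorem integrableOn_cell_of_continuous {N : ℕ} {f : Vec N → ℝ} (hf : Continuous f) :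
    IntegrableOn f (unitCube N) :=
  (hf.continuousOn.integrableOn_compact (isCompact_Icc (a := (0 : Vec N)) (b := 1))).mono_set
    (closure_unitCube (N := N) ▸ subset_closure)

theorem IsYPeriodic.eq_zero_of_ae {N : ℕ} {f : Vec N → ℝ} (hf : IsYPeriodic f) (hc : Continuous f)
    (h0 : ∀ᵐ y ∂(volOn (unitCube N)), f y = 0) (y : Vec N) : f y = 0 := by
  have h1 : EqOn f 0 (unitCube N) :=
    Measure.eqOn_open_of_ae_eq (μ := volume) h0 isOpen_unitCube hc.continuousOn continuousOn_const
  have h2 : EqOn f 0 (closure (unitCube N)) := h1.closure hc continuous_const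
  obtain ⟨z, hz, h⟩ := hf.exists_cell y
  rw [h]
  exact h2 (closure_unitCube (N := N) ▸ hz)

/-- Along every segment from `y` to `y + e_i` the derivative integrates to `f(y + e_i) - f(y) = 0`.
Averaging over `y` and exchanging the integrals gives the claim, since each shift leaves the cell
integral unchanged. This avoids boundary terms on the cube. -/
theorem IsYPeriodic.integral_partialD_eq_zero {N : ℕ} {f : Vec N → ℝ} (hf : IsYPeriodic f)
    (hs : ContDiff ℝ ∞ f) (i : Fin N) : ∫ y in unitCube N, LambdaScale.partialD i f y = 0 := by
  set g := LambdaScale.partialD i f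
  have hg : Continuous g := (hs.partialD i).continuous
  have hgp : IsYPeriodic g := hf.partialD i
  have hftc : ∀ y : Vec N, ∫ s in (0 : ℝ)..1, g (y + s • Pi.single i 1) = 0 := by
    intro y
    have hd : ∀ s ∈ Set.uIcc (0 : ℝ) 1, HasDerivAt (fun s : ℝ => f (y + s • Pi.single i 1))
        (g (y + s • Pi.single i 1)) s := by
      intro s _
      have h1 : HasDerivAt (fun s : ℝ => y + s • (Pi.single i 1 : Vec N)) (Pi.single i 1) s := by
        simpa using ((hasDerivAt_id s).smul_const (Pi.single i 1 : Vec N)).const_add y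
      exact ((hs.differentiable (by simp)) _).hasFDerivAt.comp_hasDerivAt s h1
    rw [intervalIntegral.integral_eq_sub_of_hasDerivAt hd
      ((hg.comp (by fun_prop)).intervalIntegrable _ _)]
    have := hf (Pi.single i 1) y
    rw [sub_eq_zero, zero_smul, add_zero, one_smul, ← this]
    congr 2
    ext j
    by_cases h : j = i
    · subst h; simp
    · simp [h]
  have h1 : ∫ y in unitCube N, ∫ s in (0 : ℝ)..1, g (y + s • Pi.single i 1) = 0 := by
    simp [hftc]
  rw [← h1]
  simp only [intervalIntegral.integral_of_le zero_le_one]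
  rw [integral_integral_swap]
  · simp_rw [setIntegral_unitCube_add hgp]
    simp
  · have hc : Continuous (Function.uncurry fun (y : Vec N) (s : ℝ) => g (y + s • Pi.single i 1)) :=
      hg.comp (by fun_prop)
    rw [Measure.prod_restrict]
    refine (hc.continuousOn.integrableOn_compact
      ((isCompact_Icc (a := (0 : Vec N)) (b := 1)).prod
        (isCompact_Icc (a := (0 : ℝ)) (b := 1)))).mono_set ?_
    exact Set.prod_mono (closure_unitCube (N := N) ▸ subset_closure) Ioc_subset_Icc_self

theorem integral_mul_partialD {N : ℕ} {f g : Vec N → ℝ} (hf : IsYPeriodic f) (hg : IsYPeriodic g)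
    (hfs : ContDiff ℝ ∞ f) (hgs : ContDiff ℝ ∞ g) (i : Fin N) :
    ∫ y in unitCube N, f y * partialD i g y = -∫ y in unitCube N, partialD i f y * g y := by
  have h := (hf.mul hg).integral_partialD_eq_zero (hfs.mul hgs) i
  have h1 : ∀ y, partialD i (fun y => f y * g y) y = f y * partialD i g y + partialD i f y * g y := by
    intro y
    unfold partialD
    rw [fderiv_fun_mul (hfs.differentiable (by simp) y) (hgs.differentiable (by simp) y)]
    simp [mul_comm]
  simp only [h1] at h
  have h2 := integral_add (integrableOn_cell_of_continuous
      (hfs.continuous.mul (hgs.partialD i).continuous))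
    (integrableOn_cell_of_continuous ((hfs.partialD i).continuous.mul hgs.continuous))
  simp only [Pi.mul_apply] at h2
  linarith

/-! ### The Banach space `C_per(Y)`. -/

theorem isClosed_Cper {N : ℕ} : IsClosed (Cper N : Set (Vec N →ᵇ ℝ)) := by
  have : (Cper N : Set (Vec N →ᵇ ℝ)) =
      ⋂ (k : Fin N → ℤ) (y : Vec N), {f | f (y + fun i => (k i : ℝ)) = f y} := by
    ext f
    simp only [Set.mem_iInter]
    rfl
  rw [this]
  refine isClosed_iInter fun k => isClosed_iInter fun y => ?_
  exact isClosed_eq (continuous_eval_const _)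
    (continuous_eval_const _)

instance {N : ℕ} : CompleteSpace (Cper N) := isClosed_Cper.completeSpace_coe

/-- A continuous periodic function as an element of `C_per(Y)`. -/
def Cper.mk {N : ℕ} (f : Vec N → ℝ) (hc : Continuous f) (hp : IsYPeriodic f) : Cper N :=
  ⟨BoundedContinuousFunction.ofNormedAddCommGroup f hc
    ((isCompact_Icc (a := (0 : Vec N)) (b := 1)).exists_bound_of_continuousOn
      hc.continuousOn).choose (by
      intro y
      obtain ⟨z, hz, h⟩ := hp.exists_cell y
      rw [h]
      exact ((isCompact_Icc (a := (0 : Vec N)) (b := 1)).exists_bound_of_continuousOn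
        hc.continuousOn).choose_spec z hz), hp⟩

theorem Cper.norm_le {N : ℕ} (f : Cper N) {C : ℝ} (hC : 0 ≤ C)
    (h : ∀ y, |(f : Vec N →ᵇ ℝ) y| ≤ C) : ‖f‖ ≤ C :=
  (BoundedContinuousFunction.norm_le hC).2 h

theorem Cper.ext_apply {N : ℕ} {f g : Cper N}
    (h : ∀ y, (f : Vec N →ᵇ ℝ) y = (g : Vec N →ᵇ ℝ) y) : f = g :=
  Subtype.ext (BoundedContinuousFunction.ext h)

theorem Cper.uniformContinuous {N : ℕ} (f : Cper N) : UniformContinuous (f : Vec N →ᵇ ℝ) := by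
  have hK : IsCompact (Set.Icc (-1 : Vec N) 2) := isCompact_Icc
  have hu := hK.uniformContinuousOn_of_continuous (f : Vec N →ᵇ ℝ).continuous.continuousOn
  rw [Metric.uniformContinuousOn_iff] at hu
  rw [Metric.uniformContinuous_iff]
  intro ε hε
  obtain ⟨δ, hδ, h⟩ := hu ε hε
  -- Shifting both points by the integer part of `x` puts `x` in `[0,1]^N`; the bound `1` on the
  -- distance then keeps `y` in `[-1,2]^N`.
  refine ⟨min δ 1, lt_min hδ one_pos, fun {x y} hxy => ?_⟩
  set k : Fin N → ℤ := fun i => -⌊x i⌋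
  have hx := f.2 k x
  have hy := f.2 k y
  rw [← hx, ← hy]
  have hd : dist (x + fun i => (k i : ℝ)) (y + fun i => (k i : ℝ)) = dist x y :=
    dist_add_right _ _ _
  have hxm : ∀ i, x i + k i = Int.fract (x i) := fun i => by
    simp only [k, Int.cast_neg, ← sub_eq_add_neg]; rfl
  refine h _ ⟨fun i => ?_, fun i => ?_⟩ _ ⟨fun i => ?_, fun i => ?_⟩
    (hd ▸ hxy.trans_le (min_le_left _ _))
  · have := Int.fract_nonneg (x i)
    simp only [Pi.add_apply, hxm, Pi.neg_apply, Pi.one_apply]; linarith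
  · have := Int.fract_lt_one (x i)
    simp only [Pi.add_apply, hxm, Pi.ofNat_apply]; linarith
  all_goals
    have h1 : |x i - y i| < 1 :=
      ((dist_le_pi_dist x y i).trans_lt hxy).trans_le (min_le_right _ _)
    rw [abs_lt] at h1
    have h2 := Int.fract_nonneg (x i)
    have h3 := Int.fract_lt_one (x i)
    have h4 := hxm i
    simp only [Pi.add_apply, Pi.neg_apply, Pi.ofNat_apply]
    linarith

/-! ### Mean value limit for oscillating integrals. -/

theorem tendsto_integral_norm_translate_sub {N : ℕ} {E : Type} [NormedAddCommGroup E]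
    {G : Vec N → E} (hG : Integrable G) :
    Tendsto (fun s : Vec N => ∫ z, ‖G (s + z) - G z‖) (𝓝 0) (𝓝 0) := by
  have : Fact ((1 : ℝ≥0∞) ≠ ⊤) := ⟨ENNReal.one_ne_top⟩
  set f : Lp E 1 (volume : Measure (Vec N)) := hG.toL1 G
  have hc : Continuous fun s : Vec N => DomAddAct.mk s +ᵥ f :=
    (DomAddAct.continuous_mk).vadd continuous_const
  have h0 : Tendsto (fun s : Vec N => ‖(DomAddAct.mk s +ᵥ f) - f‖) (𝓝 0) (𝓝 0) := by
    have := ((hc.sub (continuous_const (y := f))).norm).tendsto (0 : Vec N)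
    simpa using this
  refine h0.congr fun s => ?_
  rw [L1.norm_eq_integral_norm]
  refine integral_congr_ae ?_
  have hf : f =ᵐ[volume] G := hG.coeFn_toL1
  have hf' := (measurePreserving_vadd s (volume : Measure (Vec N))).quasiMeasurePreserving.ae_eq_comp hf
  filter_upwards [Lp.coeFn_sub (DomAddAct.mk s +ᵥ f) f, DomAddAct.vadd_Lp_ae_eq (DomAddAct.mk s) f,
    hf, hf'] with z h1 h2 h3 h4
  rw [h1, Pi.sub_apply, h2, h3]
  congr 2

theorem aestronglyMeasurable_eval {N : ℕ} {T : Type} [MeasurableSpace T] {μ : Measure T}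
    {G : T → Cper N} {β : T → Vec N} (hG : AEStronglyMeasurable G μ)
    (hβ : AEStronglyMeasurable β μ) :
    AEStronglyMeasurable (fun x => (G x : Vec N →ᵇ ℝ) (β x)) μ :=
  continuous_eval_Cper.comp_aestronglyMeasurable (hG.prodMk hβ)

theorem integrable_eval {N : ℕ} {T : Type} [MeasurableSpace T] {μ : Measure T}
    {G : T → Cper N} {β : T → Vec N} (hG : Integrable G μ) (hβ : AEStronglyMeasurable β μ) :
    Integrable (fun x => (G x : Vec N →ᵇ ℝ) (β x)) μ :=
  hG.mono (aestronglyMeasurable_eval hG.1 hβ) (ae_of_all _ fun x => abs_eval_le (G x) (β x))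

/-- With `A = ∫ G(z)(hz) dz` and `B(t) = ∫ G(z)(hz + t) dz`, periodicity makes the mean of `B` over
the cell equal to the limit for every `h`. So it suffices that `A - B(t)` is small uniformly in `t ∈
Y`. -/
theorem tendsto_integral_scale {N : ℕ} {G : Vec N → Cper N} (hG : Integrable G) :
    Tendsto (fun h : ℕ+ => ∫ z, (G z : Vec N →ᵇ ℝ) ((h : ℝ) • z)) atTop
      (𝓝 (∫ z, ∫ t in unitCube N, (G z : Vec N →ᵇ ℝ) t)) := by
  rw [Metric.tendsto_atTop]
  intro ε hε
  obtain ⟨δ, hδ, hδ'⟩ := Metric.tendsto_nhds_nhds.1 (tendsto_integral_norm_translate_sub hG)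
    (ε / 2) (half_pos hε)
  obtain ⟨n, hn⟩ := exists_nat_gt (1 / δ)
  refine ⟨n.succPNat, fun h hh => ?_⟩
  have hpos : (0 : ℝ) < h := by exact_mod_cast h.pos
  have hlt : 1 / δ < h := by
    refine hn.trans_le ?_
    have : n.succ ≤ (h : ℕ) := hh
    exact_mod_cast (Nat.le_succ n).trans this
  set A : ℝ := ∫ z, (G z : Vec N →ᵇ ℝ) ((h : ℝ) • z)
  set B : Vec N → ℝ := fun t => ∫ z, (G z : Vec N →ᵇ ℝ) ((h : ℝ) • z + t)
  have hint : Integrable (fun p : Vec N × Vec N => (G p.1 : Vec N →ᵇ ℝ) ((h : ℝ) • p.1 + p.2))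
      ((volume : Measure (Vec N)).prod (volOn (unitCube N))) :=
    integrable_eval (hG.comp_fst _)
      (Continuous.aestronglyMeasurable (by fun_prop))
  have hB : ∫ t in unitCube N, B t = ∫ z, ∫ t in unitCube N, (G z : Vec N →ᵇ ℝ) t := by
    rw [← integral_integral_swap hint]
    refine integral_congr_ae (ae_of_all _ fun z => ?_)
    have := setIntegral_unitCube_add (G z).2 ((h : ℝ) • z)
    simpa only [add_comm] using this
  have hAB : ∀ t ∈ unitCube N, ‖A - B t‖ ≤ ε / 2 := by
    intro t ht
    set s : Vec N := (h : ℝ)⁻¹ • t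
    have hs : dist s 0 < δ := by
      have ht1 : ‖t‖ ≤ 1 := by
        rw [pi_norm_le_iff_of_nonneg zero_le_one]
        intro i
        have := ht i (mem_univ i)
        rw [Real.norm_eq_abs, abs_le]
        constructor <;> linarith [this.1, this.2]
      rw [dist_zero_right, norm_smul, norm_inv, Real.norm_of_nonneg hpos.le]
      have h1 : (h : ℝ)⁻¹ < δ := by
        rw [inv_lt_comm₀ hpos hδ, ← one_div]; exact hlt
      have h2 : (h : ℝ)⁻¹ * ‖t‖ ≤ (h : ℝ)⁻¹ * 1 := by gcongr
      linarith
    -- Substituting `s + z` for `z`, with `s = t/h`, gives `A` the same phase `hz + t` as `B t`. The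
    -- difference is then at most the `L¹` norm of `G(s + ·) - G`, where `‖s‖ ≤ 1/h < δ`.
    have hA : A = ∫ z, (G (s + z) : Vec N →ᵇ ℝ) ((h : ℝ) • z + t) := by
      simp only [A]
      rw [← integral_add_left_eq_self (fun z => (G z : Vec N →ᵇ ℝ) ((h : ℝ) • z)) s]
      congr! 3 with z
      rw [smul_add, smul_inv_smul₀ hpos.ne', add_comm]
    have hGs : Integrable fun z => G (s + z) := hG.comp_add_left s
    have hβ : AEStronglyMeasurable (fun z : Vec N => (h : ℝ) • z + t) volume :=
      Continuous.aestronglyMeasurable (by fun_prop)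
    rw [hA, ← integral_sub (integrable_eval hGs hβ) (integrable_eval hG hβ)]
    refine (norm_integral_le_integral_norm _).trans ?_
    have hle : ∫ z, ‖(G (s + z) : Vec N →ᵇ ℝ) ((h : ℝ) • z + t) -
        (G z : Vec N →ᵇ ℝ) ((h : ℝ) • z + t)‖ ≤ ∫ z, ‖G (s + z) - G z‖ := by
      refine integral_mono ((integrable_eval hGs hβ).sub (integrable_eval hG hβ)).norm
        (hGs.sub hG).norm fun z => ?_
      exact abs_eval_le (G (s + z) - G z) ((h : ℝ) • z + t)
    refine hle.trans ?_
    have := hδ' hs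
    rw [dist_zero_right] at this
    exact (le_abs_self _).trans this.le
  have hBi : Integrable B (volOn (unitCube N)) := hint.integral_prod_right
  have key : ‖∫ t in unitCube N, (A - B t)‖ ≤ ε / 2 * 1 := by
    have := norm_integral_le_of_norm_le_const (μ := volOn (unitCube N))
      ((ae_restrict_iff' measurableSet_unitCube).2 (ae_of_all _ hAB))
    simpa using this
  rw [integral_sub (integrable_const _) hBi, integral_cell_const, hB] at key
  rw [Real.dist_eq]
  rw [Real.norm_eq_abs] at key
  linarith

/-! ### The maps `α^h` and the change of variables. -/

theorem alphaEx_eq_smul (h : ℕ+) (x : Vec 2) : alphaEx h x = (h : ℝ) • alphaEx 1 x := by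
  ext i
  fin_cases i <;> simp [alphaEx]

theorem hasFDerivAt_alphaEx (h : ℕ+) {x : Vec 2} (hx : 0 < x 1) :
    HasFDerivAt (alphaEx h)
      ((h : ℝ) • (Matrix.toLin' (Matrix.diagonal fun i => zetaEx i x)).toContinuousLinearMap) x := by
  rw [hasFDerivAt_pi']
  have h0 : HasFDerivAt (fun x : Vec 2 => x 0) (ContinuousLinearMap.proj (R := ℝ) 0) x :=
    (ContinuousLinearMap.proj (R := ℝ) (φ := fun _ : Fin 2 => ℝ) 0).hasFDerivAt
  have h1 : HasFDerivAt (fun x : Vec 2 => x 1) (ContinuousLinearMap.proj (R := ℝ) 1) x :=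
    (ContinuousLinearMap.proj (R := ℝ) (φ := fun _ : Fin 2 => ℝ) 1).hasFDerivAt
  intro i
  fin_cases i
  · refine (h0.const_mul (h : ℝ)).congr_fderiv ?_
    ext v
    simp [zetaEx]
  · have h2 := ((h1.mul h1).const_mul (h : ℝ))
    refine (h2.congr_of_eventuallyEq ?_).congr_fderiv ?_
    -- Near `x` the second coordinate stays positive, so `x₂|x₂|` coincides with `x₂²`.
    · have hev : ∀ᶠ y : Vec 2 in 𝓝 x, 0 < y 1 :=
        (continuous_apply 1).continuousAt.eventually (lt_mem_nhds hx)
      filter_upwards [hev] with y hy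
      simp [alphaEx, abs_of_pos hy]
    · ext v
      simp [zetaEx]
      ring

theorem mul_abs_strictMono : StrictMono fun t : ℝ => t * |t| := by
  intro s t hst
  rcases le_or_gt 0 s with hs | hs
  · simp only [abs_of_nonneg hs, abs_of_nonneg (hs.trans hst.le)]
    nlinarith
  · rcases le_or_gt 0 t with ht | ht
    · simp only [abs_of_neg hs, abs_of_nonneg ht]
      nlinarith
    · simp only [abs_of_neg hs, abs_of_neg ht]
      nlinarith

theorem bijective_alphaEx (h : ℕ+) : Function.Bijective (alphaEx h) := by
  have hpos : (h : ℝ) ≠ 0 := by exact_mod_cast h.ne_zero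
  constructor
  · intro x y hxy
    have h0 := congrFun hxy 0
    have h1 := congrFun hxy 1
    simp only [alphaEx, ContinuousMap.coe_mk, Matrix.cons_val_zero, Matrix.cons_val_one] at h0 h1
    ext i
    fin_cases i
    · exact mul_left_cancel₀ hpos h0
    · exact mul_abs_strictMono.injective (mul_left_cancel₀ hpos h1)
  · intro z
    have hs : Function.Surjective fun t : ℝ => t * |t| := by
      intro u
      rcases le_total 0 u with hu | hu
      · exact ⟨√u, by simp [abs_of_nonneg (Real.sqrt_nonneg u), Real.mul_self_sqrt hu]⟩
      · refine ⟨-√(-u), ?_⟩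
        have := Real.mul_self_sqrt (neg_nonneg.2 hu)
        simp only [abs_neg, abs_of_nonneg (Real.sqrt_nonneg (-u))]
        linarith
    obtain ⟨t, ht⟩ := hs (z 1 / h)
    refine ⟨![z 0 / h, t], ?_⟩
    ext i
    fin_cases i
    · simp [alphaEx]; field_simp
    · simp only [alphaEx, ContinuousMap.coe_mk]
      simp only [Fin.mk_one, Matrix.cons_val_one]
      simp only at ht
      simp [ht]; field_simp

theorem measurableSet_box (a b : Vec 2) : MeasurableSet (box a b) :=
  MeasurableSet.univ_pi fun _ => measurableSet_Ioo

theorem pos_of_mem_box {a b : Vec 2} (ha : ∀ i, 0 < a i) {x : Vec 2} (hx : x ∈ box a b) (i : Fin 2) :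
    0 < x i :=
  (ha i).trans (hx i (mem_univ i)).1

/-- As `α^h = h f` with `f = α^1`, the substitution `z = f(x)` turns the phase into `hz`, and
`tendsto_integral_scale` applies to the density transported to `f(Ω)` and extended by zero. -/
theorem tendsto_integral_comp_alphaEx {a b : Vec 2} (ha : ∀ i, 0 < a i) {F : Vec 2 → Cper 2}
    (hF : Integrable F (volOn (box a b))) :
    Tendsto (fun h : ℕ+ => ∫ x in box a b, (F x : Vec 2 →ᵇ ℝ) (alphaEx h x)) atTop
      (𝓝 (∫ x in box a b, ∫ t in unitCube 2, (F x : Vec 2 →ᵇ ℝ) t)) := by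
  set Ω := box a b
  set f : Vec 2 → Vec 2 := fun x => alphaEx 1 x
  set f' : Vec 2 → Vec 2 →L[ℝ] Vec 2 := fun x =>
    (((1 : ℕ+) : ℝ) • (Matrix.toLin' (Matrix.diagonal fun i => zetaEx i x)).toContinuousLinearMap)
  have hf' : ∀ x ∈ Ω, HasFDerivWithinAt f (f' x) Ω x := fun x hx =>
    (hasFDerivAt_alphaEx 1 (pos_of_mem_box ha hx 1)).hasFDerivWithinAt
  have hinj : Function.Injective f := (bijective_alphaEx 1).1
  have hm : MeasurableSet Ω := measurableSet_box a b
  have hmi : MeasurableSet (f '' Ω) := measurable_image_of_fderivWithin hm hf' hinj.injOn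
  have hdet : ∀ x ∈ Ω, |(f' x).det| ≠ 0 := by
    intro x hx
    have : (f' x).det = 2 * x 1 := by
      simp [f', ContinuousLinearMap.det, zetaEx]
    rw [this]
    have := pos_of_mem_box ha hx 1
    positivity
  set g := Function.invFun f
  have hg : ∀ x, g (f x) = x := Function.leftInverse_invFun hinj
  set G : Vec 2 → Cper 2 := fun z => |(f' (g z)).det|⁻¹ • F (g z)
  have hGf : ∀ x ∈ Ω, |(f' x).det| • G (f x) = F x := by
    intro x hx
    simp only [G, hg]
    rw [smul_inv_smul₀ (hdet x hx)]
  have hGi : IntegrableOn G (f '' Ω) := by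
    rw [integrableOn_image_iff_integrableOn_abs_det_fderiv_smul volume hm hf' hinj.injOn]
    exact (integrableOn_congr_fun hGf hm).2 hF
  have key := tendsto_integral_scale (hGi.integrable_indicator hmi)
  -- The oscillating integral and its limit both integrate a functional homogeneous in the second
  -- argument, so a single substitution serves for both; the Jacobian cancels the inverse factor in
  -- `G`.
  have hcv : ∀ Φ : Vec 2 → Cper 2 → ℝ, (∀ z, Φ z 0 = 0) →
      (∀ z (c : ℝ) u, Φ z (c • u) = c * Φ z u) →
      ∫ z, Φ z ((f '' Ω).indicator G z) = ∫ x in Ω, Φ (f x) (F x) := by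
    intro Φ h0 hs
    have h1 : (fun z => Φ z ((f '' Ω).indicator G z)) =
        (f '' Ω).indicator fun z => Φ z (G z) := by
      ext z
      by_cases hz : z ∈ f '' Ω <;> simp [hz, h0]
    rw [h1, integral_indicator hmi,
      integral_image_eq_integral_abs_det_fderiv_smul volume hm hf' hinj.injOn]
    refine setIntegral_congr_fun hm fun x hx => ?_
    simp only [smul_eq_mul]
    rw [← hs, hGf x hx]
  have e1 := hcv (fun _ u => ∫ t in unitCube 2, (u : Vec 2 →ᵇ ℝ) t) (by simp)
    (fun z c u => by simp [integral_const_mul])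
  rw [e1] at key
  refine key.congr fun h => ?_
  have e2 := hcv (fun z u => (u : Vec 2 →ᵇ ℝ) ((h : ℝ) • z)) (by simp) (fun z c u => by simp)
  rw [e2]
  simp only [alphaEx_eq_smul h, f]

/-! ### Test functions as elements of `X`, and the inclusion into `L²(Ω × Y)`. -/

/-- On the compact closed cell joint continuity gives uniform convergence in `y`; periodicity
extends it to all of `ℝ^N`. -/
theorem continuous_of_continuous_eval {N : ℕ} {T : Type} [UniformSpace T]
    [LocallyCompactSpace T] {F : T → Cper N}
    (hF : Continuous fun p : T × Vec N => (F p.1 : Vec N →ᵇ ℝ) p.2) : Continuous F := by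
  rw [continuous_iff_continuousAt]
  intro x₀
  rw [ContinuousAt, Metric.tendsto_nhds]
  intro ε hε
  have hu : TendstoUniformly (fun x (y : Set.Icc (0 : Vec N) 1) => (F x : Vec N →ᵇ ℝ) y)
      (fun y => (F x₀ : Vec N →ᵇ ℝ) y) (𝓝 x₀) :=
    Continuous.tendstoUniformly (fun x (y : Set.Icc (0 : Vec N) 1) => (F x : Vec N →ᵇ ℝ) y)
      (hF.comp (f := fun p : T × Set.Icc (0 : Vec N) 1 => (p.1, (p.2 : Vec N))) (by fun_prop)) x₀
  filter_upwards [Metric.tendstoUniformly_iff.1 hu (ε / 2) (half_pos hε)] with x hx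
  rw [dist_eq_norm]
  refine (Cper.norm_le _ (half_pos hε).le fun y => ?_).trans_lt (half_lt_self hε)
  obtain ⟨z, hz, h⟩ := IsYPeriodic.exists_cell (F x - F x₀).2 y
  rw [h]
  have := hx ⟨z, hz⟩
  rw [dist_comm, Real.dist_eq] at this
  exact this.le

theorem IsTest.continuous {N : ℕ} {Ω : Set (Vec N)} {φ : Vec N → Vec N → ℝ} (hφ : IsTest Ω φ)
    (x : Vec N) : Continuous (φ x) :=
  hφ.1.continuous.comp (by fun_prop : Continuous fun y : Vec N => (x, y))

theorem IsTest.contDiff {N : ℕ} {Ω : Set (Vec N)} {φ : Vec N → Vec N → ℝ} (hφ : IsTest Ω φ)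
    (x : Vec N) : ContDiff ℝ ∞ (φ x) :=
  hφ.1.comp (by fun_prop : ContDiff ℝ ∞ fun y : Vec N => (x, y))

/-- A test function as a map `ℝ^N → C_per(Y)`. -/
def IsTest.curried {N : ℕ} {Ω : Set (Vec N)} {φ : Vec N → Vec N → ℝ} (hφ : IsTest Ω φ)
    (x : Vec N) : Cper N :=
  Cper.mk (φ x) (hφ.continuous x) (hφ.2.1 x)

theorem IsTest.memLp_curried {N : ℕ} {Ω : Set (Vec N)} {φ : Vec N → Vec N → ℝ}
    (hφ : IsTest Ω φ) : MemLp hφ.curried 2 (volOn Ω) := by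
  obtain ⟨hs, hp, K, hK, hKΩ, h0⟩ := id hφ
  have hc : Continuous hφ.curried := continuous_of_continuous_eval hs.continuous
  have hcs : HasCompactSupport hφ.curried :=
    HasCompactSupport.intro hK fun x hx => Cper.ext_apply fun y => h0 x hx y
  exact hc.memLp_of_hasCompactSupport hcs

theorem coeFn_toL2Y {N : ℕ} {Ω : Set (Vec N)} (v : L2Cper Ω) :
    toL2Y Ω v =ᵐ[volProd Ω] fun p => (v p.1 : Vec N →ᵇ ℝ) p.2 :=
  (memLp_uncurry v).coeFn_toLp

theorem coeFn_tau {N : ℕ} {Ω : Set (Vec N)} (β : C(Vec N, Vec N)) (v : L2Cper Ω) :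
    tau Ω β v =ᵐ[volOn Ω] fun x => (v x : Vec N →ᵇ ℝ) (β x) :=
  (memLp_comp β v).coeFn_toLp

theorem toL2Y_ae_eq {N : ℕ} {Ω : Set (Vec N)} {v : L2Cper Ω} {f : Vec N → Cper N}
    (h : v =ᵐ[volOn Ω] f) :
    toL2Y Ω v =ᵐ[volProd Ω] fun p => (f p.1 : Vec N →ᵇ ℝ) p.2 := by
  filter_upwards [coeFn_toL2Y v, Measure.quasiMeasurePreserving_fst.ae h] with p h1 h2
  rw [h1, h2]

theorem exists_toL2Y_eq_test {N : ℕ} {Ω : Set (Vec N)} {φ : Vec N → Vec N → ℝ}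
    (hφ : IsTest Ω φ) : ∃ v : L2Cper Ω, toL2Y Ω v =ᵐ[volProd Ω] fun p => φ p.1 p.2 :=
  ⟨hφ.memLp_curried.toLp, toL2Y_ae_eq hφ.memLp_curried.coeFn_toLp⟩

/-- For almost every `x` the slice vanishes almost everywhere on the cell; being continuous and
periodic, it vanishes everywhere. -/
theorem toL2Y_injective {N : ℕ} (Ω : Set (Vec N)) : Function.Injective (toL2Y Ω) := by
  rw [injective_iff_map_eq_zero]
  intro v hv
  have h1 := coeFn_toL2Y v
  rw [hv] at h1
  have h2 := Measure.ae_ae_of_ae_prod (h1.symm.trans (Lp.coeFn_zero ℝ 2 (volProd Ω)))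
  refine Lp.ext ?_
  filter_upwards [h2, Lp.coeFn_zero (Cper N) 2 (volOn Ω)] with x hx h0
  rw [h0]
  exact Cper.ext_apply fun y => IsYPeriodic.eq_zero_of_ae (v x).2
    ((v x : Vec N →ᵇ ℝ).continuous) hx y

/-! ### Strong two-scale compatibility. -/

theorem norm_L2_eq_sqrt {T : Type} [MeasurableSpace T] {μ : Measure T} (f : Lp ℝ 2 μ) :
    ‖f‖ = √(∫ x, f x * f x ∂μ) := by
  have h : ∫ x, f x * f x ∂μ = inner ℝ f f := by
    rw [L2.inner_def]; rfl
  rw [h, real_inner_self_eq_norm_sq, Real.sqrt_sq (norm_nonneg _)]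

/-- Pointwise product in `C_per(Y)`. -/
def Cper.mul {N : ℕ} (f g : Cper N) : Cper N :=
  ⟨f.1 * g.1, IsYPeriodic.mul f.2 g.2⟩

theorem Cper.mul_apply {N : ℕ} (f g : Cper N) (y : Vec N) :
    (Cper.mul f g : Vec N →ᵇ ℝ) y = (f : Vec N →ᵇ ℝ) y * (g : Vec N →ᵇ ℝ) y := rfl

theorem integrable_mul_self {N : ℕ} {Ω : Set (Vec N)} (v : L2Cper Ω) :
    Integrable (fun x => Cper.mul (v x) (v x)) (volOn Ω) := by
  have hc : Continuous fun f : Cper N => Cper.mul f f :=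
    Continuous.subtype_mk (continuous_subtype_val.mul continuous_subtype_val) _
  refine (Lp.memLp v).norm.integrable_sq.mono
    (hc.comp_aestronglyMeasurable (Lp.aestronglyMeasurable v)) (ae_of_all _ fun x => ?_)
  rw [Real.norm_of_nonneg (sq_nonneg _), sq]
  exact norm_mul_le (v x : Vec N →ᵇ ℝ) (v x : Vec N →ᵇ ℝ)

/-- The oscillating limit is applied to `v²`, which lies in `L¹(Ω; C_per(Y))`. The limit is the norm
itself, so `C = 1` is admissible. -/
theorem tendsto_norm_tau {a b : Vec 2} (ha : ∀ i, 0 < a i) (v : L2Cper (box a b)) :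
    Tendsto (fun h => ‖tau (box a b) (alphaEx h) v‖) atTop (𝓝 ‖toL2Y (box a b) v‖) := by
  have key := (tendsto_integral_comp_alphaEx ha (integrable_mul_self v)).sqrt
  simp only [norm_L2_eq_sqrt]
  have e1 : ∫ p, toL2Y (box a b) v p * toL2Y (box a b) v p ∂(volProd (box a b)) =
      ∫ x in box a b, ∫ t in unitCube 2, (Cper.mul (v x) (v x) : Vec 2 →ᵇ ℝ) t := by
    rw [integral_prod]
    · refine integral_congr_ae ?_
      filter_upwards [Measure.ae_ae_of_ae_prod (coeFn_toL2Y v)] with x hx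
      refine integral_congr_ae ?_
      filter_upwards [hx] with y hy
      rw [hy, Cper.mul_apply]
    · exact (Lp.memLp _).integrable_mul (Lp.memLp _)
  rw [e1]
  refine key.congr fun h => ?_
  congr 1
  refine integral_congr_ae ?_
  filter_upwards [coeFn_tau (alphaEx h) v] with x hx
  rw [hx, Cper.mul_apply]

theorem norm_tau_le {N : ℕ} {Ω : Set (Vec N)} (β : C(Vec N, Vec N)) (v : L2Cper Ω) :
    ‖tau Ω β v‖ ≤ ‖v‖ := by
  refine Lp.norm_le_norm_of_ae_le ?_
  filter_upwards [coeFn_tau β v] with x hx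
  rw [hx]
  exact abs_eval_le _ _

/-- The variance is nonnegative. -/
theorem sq_integral_le {T : Type} [MeasurableSpace T] {μ : Measure T} [IsProbabilityMeasure μ]
    {f : T → ℝ} (hf : MemLp f 2 μ) : (∫ x, f x ∂μ) ^ 2 ≤ ∫ x, f x ^ 2 ∂μ := by
  have hi : Integrable f μ := hf.integrable one_le_two
  set m := ∫ x, f x ∂μ
  have h0 : 0 ≤ ∫ x, (f x - m) ^ 2 ∂μ := integral_nonneg fun x => sq_nonneg _
  have h1 : ∫ x, (f x - m) ^ 2 ∂μ = ∫ x, (f x ^ 2 + ((-2 * m) * f x + m ^ 2)) ∂μ := by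
    congr 1; ext x; ring
  have h2 : Integrable (fun x => (-2 * m) * f x + m ^ 2) μ :=
    (hi.const_mul _).add (integrable_const _)
  rw [h1, integral_add hf.integrable_sq h2,
    integral_add (hi.const_mul _) (integrable_const _), integral_const_mul] at h0
  simp only [integral_const, probReal_univ, one_smul] at h0
  change 0 ≤ _ + (-2 * m * m + m ^ 2) at h0
  linarith

theorem memLp_cellMean {N : ℕ} {Ω : Set (Vec N)} (u : L2Y Ω) :
    MemLp (fun x => ∫ y in unitCube N, u (x, y)) 2 (volOn Ω) := by
  have hm : AEStronglyMeasurable (fun x => ∫ y in unitCube N, u (x, y)) (volOn Ω) :=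
    (Lp.aestronglyMeasurable u).integral_prod_right'
  rw [memLp_two_iff_integrable_sq hm]
  refine (Lp.memLp u).integrable_sq.integral_prod_left.mono (hm.pow 2) ?_
  filter_upwards [ae_memLp_section u] with x hx
  rw [Real.norm_of_nonneg (sq_nonneg _),
    Real.norm_of_nonneg (integral_nonneg fun y => sq_nonneg _)]
  exact sq_integral_le hx

theorem weakTendsto_tau {a b : Vec 2} (ha : ∀ i, 0 < a i) (v : L2Cper (box a b)) :
    WeakTendsto (box a b) (fun h => tau (box a b) (alphaEx h) v)
      fun x => ∫ y in unitCube 2, toL2Y (box a b) v (x, y) := by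
  refine ⟨fun h => Lp.memLp _, memLp_cellMean _, fun g hg => ?_⟩
  have hF : Integrable (fun x => g x • v x) (volOn (box a b)) :=
    memLp_one_iff_integrable.1 ((Lp.memLp v).smul hg)
  have key := tendsto_integral_comp_alphaEx ha hF
  have e1 : ∫ x in box a b, ∫ t in unitCube 2, ((g x • v x : Cper 2) : Vec 2 →ᵇ ℝ) t =
      ∫ x in box a b, (∫ y in unitCube 2, toL2Y (box a b) v (x, y)) * g x := by
    refine integral_congr_ae ?_
    filter_upwards [Measure.ae_ae_of_ae_prod (coeFn_toL2Y v)] with x hx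
    rw [integral_congr_ae hx, mul_comm, ← integral_const_mul]
    rfl
  rw [e1] at key
  refine key.congr fun h => ?_
  refine integral_congr_ae ?_
  filter_upwards [coeFn_tau (alphaEx h) v] with x hx
  rw [hx, mul_comm]
  rfl

/-- Functions `g(x)` constant in `y` belong to `X`, and `τ^h` leaves them unchanged; testing with
them is weak convergence. -/
theorem weakTendsto_of_twoScaleConverges {N : ℕ} {Ω : Set (Vec N)} {β : ℕ+ → C(Vec N, Vec N)}
    {u : ℕ+ → L2 Ω} {u₀ : L2Y Ω}
    (h : TwoScaleConverges Ω (toL2Y Ω) (fun h => tau Ω (β h)) u u₀) :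
    WeakTendsto Ω (fun h => u h) fun x => ∫ y in unitCube N, u₀ (x, y) := by
  refine ⟨fun h => Lp.memLp _, memLp_cellMean _, fun g hg => ?_⟩
  set e : Cper N := Cper.mk (fun _ => 1) continuous_const fun _ _ => rfl
  have he : ∀ (c : ℝ) y, ((c • e : Cper N) : Vec N →ᵇ ℝ) y = c := fun c y => mul_one c
  have hge : MemLp (fun x => g x • e) 2 (volOn Ω) :=
    (memLp_top_const e).smul hg
  have hae := hge.coeFn_toLp
  have key := h hge.toLp
  have e1 : ∫ p, u₀ p * toL2Y Ω hge.toLp p ∂(volProd Ω) =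
      ∫ x in Ω, (∫ y in unitCube N, u₀ (x, y)) * g x := by
    rw [integral_prod]
    · refine integral_congr_ae ?_
      filter_upwards [Measure.ae_ae_of_ae_prod (toL2Y_ae_eq hae)] with x hx
      rw [← integral_mul_const]
      refine integral_congr_ae ?_
      filter_upwards [hx] with y hy
      rw [hy, he]
    · exact (Lp.memLp _).integrable_mul (Lp.memLp _)
  rw [e1] at key
  refine key.congr fun n => ?_
  refine integral_congr_ae ?_
  filter_upwards [coeFn_tau (β n) hge.toLp, hae] with x h1 h2
  rw [h1, h2, he]

theorem isStronglyTwoScaleCompatible_alphaEx {a b : Vec 2} (ha : ∀ i, 0 < a i) :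
    IsStronglyTwoScaleCompatible (box a b) (toL2Y (box a b))
      fun h => tau (box a b) (alphaEx h) := by
  refine ⟨⟨1, one_pos, fun v => ⟨⟨_, tendsto_norm_tau ha v, (one_mul _).ge⟩, fun h => ?_⟩⟩,
    fun u u₀ _ h => weakTendsto_of_twoScaleConverges h, weakTendsto_tau ha⟩
  rw [one_mul]
  exact norm_tau_le _ _

/-! ### The gradient condition with `p^h = 1/h`. -/

theorem partialD_alphaEx (h : ℕ+) {x : Vec 2} (hx : 0 < x 1) (i j : Fin 2) :
    partialD i (fun x' => alphaEx h x' j) x =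
      h * Matrix.diagonal (fun k => zetaEx k x) i j := by
  have h1 := (hasFDerivAt_pi'.1 (hasFDerivAt_alphaEx h hx)) j
  rw [partialD, h1.fderiv]
  fin_cases i <;> fin_cases j <;> simp

theorem integral_partialD_eq_zero {N : ℕ} {φ : Vec N → ℝ} (hφ : ContDiff ℝ ∞ φ)
    (hc : HasCompactSupport φ) (i : Fin N) : ∫ x, partialD i φ x = 0 := by
  have hd : Continuous fun x => fderiv ℝ φ x (Pi.single i 1) := (hφ.partialD i).continuous
  have h := integral_mul_fderiv_eq_neg_fderiv_mul_of_integrable (μ := (volume : Measure (Vec N)))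
    (f := fun _ => (1 : ℝ)) (g := φ) (v := Pi.single i 1) (by simp)
    (by simpa using hd.integrable_of_hasCompactSupport (hc.fderiv_apply ℝ _))
    (by simpa using hφ.continuous.integrable_of_hasCompactSupport hc)
    (fun x _ => differentiableAt_const _) (fun x _ => hφ.differentiable (by simp) x)
  simpa [partialD] using h

theorem isWeakPartial_const {N : ℕ} (Ω : Set (Vec N)) (i : Fin N) (c : ℝ) :
    IsWeakPartial Ω i (fun _ => c) 0 := by
  intro φ hφ hc hs
  have h0 : ∀ x, x ∉ Ω → partialD i φ x = 0 := by
    intro x hx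
    have : x ∉ tsupport φ := fun h => hx (hs h)
    rw [partialD, fderiv_of_notMem_tsupport ℝ this]
    simp
  rw [integral_const_mul, setIntegral_eq_integral_of_forall_compl_eq_zero h0,
    integral_partialD_eq_zero hφ hc]
  simp

theorem isFiniteMeasure_box (a b : Vec 2) : IsFiniteMeasure (volOn (box a b)) := by
  refine ⟨?_⟩
  rw [Measure.restrict_apply_univ, box, Real.volume_pi_Ioo]
  exact ENNReal.prod_lt_top fun i _ => ENNReal.ofReal_lt_top

theorem memLp_zetaEx {a b : Vec 2} (ha : ∀ i, 0 < a i) (i : Fin 2) :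
    MemLp (zetaEx i) ⊤ (volOn (box a b)) := by
  have hc : Continuous (zetaEx i) := by
    fin_cases i <;> simp [zetaEx] <;> fun_prop
  refine memLp_top_of_bound hc.aestronglyMeasurable (1 + 2 * b 1) ?_
  refine (ae_restrict_iff' (measurableSet_box a b)).2 (ae_of_all _ fun x hx => ?_)
  have h1 := pos_of_mem_box ha hx 1
  have h2 : x 1 < b 1 := (hx 1 (mem_univ _)).2
  fin_cases i
  · simp [zetaEx]; linarith
  · simp [zetaEx, abs_of_pos h1]; linarith

theorem StrongTendsto.of_ae_eq {N : ℕ} {Ω : Set (Vec N)} {f : ℕ+ → Vec N → ℝ} {f₀ : Vec N → ℝ}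
    (h₀ : MemLp f₀ 2 (volOn Ω)) (h : ∀ n, f n =ᵐ[volOn Ω] f₀) : StrongTendsto Ω f f₀ := by
  refine ⟨fun n => h₀.ae_eq (h n).symm, h₀, ?_⟩
  have : ∀ n, eLpNorm (fun x => f n x - f₀ x) 2 (volOn Ω) = 0 := by
    intro n
    rw [eLpNorm_congr_ae (g := 0), eLpNorm_zero]
    filter_upwards [h n] with x hx
    simp [hx]
  simp [this]

theorem gradientCondition_alphaEx {a b : Vec 2} (ha : ∀ i, 0 < a i) :
    GradientCondition (box a b) alphaEx zetaEx (fun h _ => 1 / (h : ℝ)) := by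
  have := isFiniteMeasure_box a b
  refine ⟨⟨⟨fun h => memLp_const _, MemLp.zero, ?_⟩, fun _ _ => 0,
    fun i h => isWeakPartial_const _ i _,
    fun i => StrongTendsto.of_ae_eq MemLp.zero fun _ => EventuallyEq.rfl⟩,
    memLp_zetaEx ha, fun i j => StrongTendsto.of_ae_eq ?_ fun h => ?_⟩
  -- This is the `L²` norm of the constant `1/h`; it tends to zero because the box has finite
  -- measure. The weak derivatives are zero, and the matrix convergence is an equality on `Ω` for
  -- each `h`.
  · have hlim : Tendsto (fun h : ℕ+ => ENNReal.ofReal (1 / (h : ℝ)) *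
        (volOn (box a b)) univ ^ (1 / (2 : ℝ≥0∞).toReal)) atTop (𝓝 0) := by
      have h1 : Tendsto (fun h : ℕ+ => (1 / (h : ℝ))) atTop (𝓝 0) :=
        tendsto_one_div_atTop_nhds_zero_nat.comp tendsto_PNat_val_atTop_atTop
      have h2 := (ENNReal.tendsto_ofReal h1)
      rw [ENNReal.ofReal_zero] at h2
      have h3 := ENNReal.Tendsto.mul_const (b := (volOn (box a b)) univ ^ (1 / (2 : ℝ≥0∞).toReal))
        h2 (Or.inr (ENNReal.rpow_ne_top_of_nonneg (by positivity) (measure_ne_top _ _)))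
      simpa using h3
    refine hlim.congr fun h => ?_
    simp only [Pi.zero_apply, sub_zero]
    rw [eLpNorm_const' _ (by simp) (by simp), Real.enorm_eq_ofReal (by positivity)]
  · by_cases hij : i = j
    · subst hij
      simpa using (memLp_zetaEx ha i).mono_exponent le_top
    · simp [hij]
  · refine (ae_restrict_iff' (measurableSet_box a b)).2 (ae_of_all _ fun x hx => ?_)
    dsimp only
    have hpos : (h : ℝ) ≠ 0 := by exact_mod_cast h.ne_zero
    rw [partialD_alphaEx h (pos_of_mem_box ha hx 1)]
    field_simp

/-! ### The divergence constraint and the weak limit in (iii). -/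

/-- `∑ ζ_i ∂e_i/∂y_i = 0` in the sense of weak derivatives of periodic functions. -/
def IsDivFree {N : ℕ} (ζ : Fin N → ℝ) (e : Fin N → Vec N → ℝ) : Prop :=
  ∀ ψ : Vec N → ℝ, ContDiff ℝ ∞ ψ → IsYPeriodic ψ →
    ∑ i, ζ i * ∫ y in unitCube N, e i y * partialD i ψ y = 0

theorem mem_divFreeL2 {N : ℕ} {Ω : Set (Vec N)} {ζ : Fin N → Vec N → ℝ} {v : Fin N → L2Y Ω} :
    v ∈ divFreeL2 Ω ζ ↔
      ∀ᵐ x ∂(volOn Ω), IsDivFree (fun i => ζ i x) fun i y => v i (x, y) :=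
  Iff.rfl

theorem IsDivFree.congr_ae {N : ℕ} {ζ : Fin N → ℝ} {e e' : Fin N → Vec N → ℝ}
    (h : IsDivFree ζ e) (hae : ∀ i, e i =ᵐ[volOn (unitCube N)] e' i) : IsDivFree ζ e' := by
  intro ψ hψ hψp
  rw [← h ψ hψ hψp]
  refine Finset.sum_congr rfl fun i _ => congrArg (ζ i * ·) (integral_congr_ae ?_)
  filter_upwards [hae i] with y hy
  rw [hy]

theorem ae_isDivFree_iff {N : ℕ} {Ω : Set (Vec N)} {ζ : Fin N → Vec N → ℝ} {v : Fin N → L2Y Ω}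
    {φ : Fin N → Vec N → Vec N → ℝ} (hφ : ∀ i, v i =ᵐ[volProd Ω] fun p => φ i p.1 p.2) :
    v ∈ divFreeL2 Ω ζ ↔ ∀ᵐ x ∂(volOn Ω), IsDivFree (fun i => ζ i x) fun i => φ i x := by
  rw [mem_divFreeL2]
  have h := ae_all_iff.2 fun i => Measure.ae_ae_of_ae_prod (hφ i)
  constructor
  · intro hv
    filter_upwards [hv, h] with x h1 h2
    exact h1.congr_ae h2
  · intro hv
    filter_upwards [hv, h] with x h1 h2
    exact h1.congr_ae fun i => EventuallyEq.symm (h2 i)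

theorem mem_divFree_iff {N : ℕ} {Ω : Set (Vec N)} {ζ : Fin N → Vec N → ℝ}
    {v : Fin N → L2Cper Ω} {f : Fin N → Vec N → Cper N} (hf : ∀ i, v i =ᵐ[volOn Ω] f i) :
    v ∈ divFree Ω ζ ↔ ∀ᵐ x ∂(volOn Ω),
      IsDivFree (fun i => ζ i x) fun i => ((f i x : Vec N →ᵇ ℝ) : Vec N → ℝ) :=
  ae_isDivFree_iff (v := fun i => toL2Y Ω (v i)) fun i => toL2Y_ae_eq (hf i)

/-- The divergence `D` is itself a smooth periodic function, hence an admissible test function.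
Integration by parts gives `∫ D² = 0`. -/
theorem IsDivFree.sum_partialD_eq_zero {N : ℕ} {ζ : Fin N → ℝ} {φ : Fin N → Vec N → ℝ}
    (h : IsDivFree ζ φ) (hs : ∀ i, ContDiff ℝ ∞ (φ i)) (hp : ∀ i, IsYPeriodic (φ i)) (y : Vec N) :
    ∑ i, ζ i * partialD i (φ i) y = 0 := by
  set D : Vec N → ℝ := fun y => ∑ i, ζ i * partialD i (φ i) y
  have hDs : ContDiff ℝ ∞ D :=
    ContDiff.sum fun i _ => contDiff_const.mul ((hs i).partialD i)
  have hDp : IsYPeriodic D := fun k y =>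
    Finset.sum_congr rfl fun i _ => by rw [(hp i).partialD i k y]
  have h1 := h D hDs hDp
  simp only [fun i => integral_mul_partialD (hp i) hDp (hs i) hDs i] at h1
  have h2 : ∫ y in unitCube N, D y * D y = 0 := by
    have e : ∀ y, D y * D y = ∑ i, ζ i * (partialD i (φ i) y * D y) := by
      intro y
      simp only [D]
      rw [Finset.sum_mul]
      simp only [mul_assoc]
    simp only [e]
    rw [integral_finsetSum]
    · simp only [integral_const_mul]
      simp only [mul_neg, Finset.sum_neg_distrib, neg_eq_zero] at h1
      exact h1
    · intro i _
      exact integrableOn_cell_of_continuous (continuous_const.mul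
        (((hs i).partialD i).continuous.mul hDs.continuous))
  rw [integral_eq_zero_iff_of_nonneg (fun y => mul_self_nonneg _)
    (integrableOn_cell_of_continuous (hDs.continuous.mul hDs.continuous))] at h2
  refine hDp.eq_zero_of_ae hDs.continuous ?_ y
  filter_upwards [h2] with y hy
  exact mul_self_eq_zero.1 hy

/-- The Jacobian matrix is `h diag(ζ)`, so the double sum is `h` times the classical divergence at
`α^h(x)`: it is zero almost everywhere for every `h`, not only in the limit. -/
theorem weakTendsto_zero_of_divFree {a b : Vec 2} (ha : ∀ i, 0 < a i)
    {φ : Fin 2 → Vec 2 → Vec 2 → ℝ} (hφ : ∀ i, IsTest (box a b) (φ i))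
    (hd : ∀ᵐ x ∂(volOn (box a b)), IsDivFree (fun i => zetaEx i x) fun i => φ i x) :
    WeakTendsto (box a b)
      (fun h x => ∑ i, ∑ k, partialD k (φ i x) (alphaEx h x) *
        partialD i (fun x' => alphaEx h x' k) x) 0 := by
  have h0 : ∀ h : ℕ+, (fun x => ∑ i, ∑ k, partialD k (φ i x) (alphaEx h x) *
      partialD i (fun x' => alphaEx h x' k) x) =ᵐ[volOn (box a b)] 0 := by
    intro h
    filter_upwards [hd, ae_restrict_mem (measurableSet_box a b)] with x h1 hx
    have h2 := h1.sum_partialD_eq_zero (fun i => (hφ i).contDiff x) (fun i => (hφ i).2.1 x)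
      (alphaEx h x)
    simp only [partialD_alphaEx h (pos_of_mem_box ha hx 1), Matrix.diagonal_apply, mul_ite,
      mul_zero, Finset.sum_ite_eq, Finset.mem_univ, if_true, Pi.zero_apply]
    calc _ = h * ∑ i, zetaEx i x * partialD i (φ i x) (alphaEx h x) := by
          rw [Finset.mul_sum]
          exact Finset.sum_congr rfl fun i _ => by ring
      _ = 0 := by rw [h2, mul_zero]
  refine ⟨fun h => MemLp.zero.ae_eq (h0 h).symm, MemLp.zero, fun g _ => ?_⟩
  refine tendsto_const_nhds.congr fun h => ?_
  refine integral_congr_ae ?_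
  filter_upwards [h0 h] with x hx
  rw [hx]

/-! ### Closedness of the constraint. -/

theorem tendsto_integral_cell_mul {N : ℕ} {f : ℕ → Vec N → ℝ} {f₀ g : Vec N → ℝ}
    (hf : ∀ n, MemLp (f n) 2 (volOn (unitCube N))) (hf₀ : MemLp f₀ 2 (volOn (unitCube N)))
    (hg : Continuous g)
    (h : Tendsto (fun n => ∫ y in unitCube N, (f n y - f₀ y) ^ 2) atTop (𝓝 0)) :
    Tendsto (fun n => ∫ y in unitCube N, f n y * g y) atTop
      (𝓝 (∫ y in unitCube N, f₀ y * g y)) := by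
  obtain ⟨C, hC⟩ := (isCompact_Icc (a := (0 : Vec N)) (b := 1)).exists_bound_of_continuousOn
    hg.continuousOn
  have hgb : ∀ᵐ y ∂(volOn (unitCube N)), ‖g y‖ ≤ C :=
    (ae_restrict_iff' measurableSet_unitCube).2 (ae_of_all _ fun y hy => hC y
      (closure_unitCube (N := N) ▸ subset_closure hy))
  have hg' : MemLp g ⊤ (volOn (unitCube N)) := memLp_top_of_bound hg.aestronglyMeasurable C hgb
  rw [tendsto_iff_norm_sub_tendsto_zero]
  have hsq : Tendsto (fun n => √(C ^ 2 * ∫ y in unitCube N, (f n y - f₀ y) ^ 2)) atTop (𝓝 0) := by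
    simpa using (h.const_mul (C ^ 2)).sqrt
  refine squeeze_zero (fun n => norm_nonneg _) (fun n => ?_) hsq
  have hd : MemLp (fun y => (f n y - f₀ y) * g y) 2 (volOn (unitCube N)) :=
    MemLp.mul (r := 2) hg' ((hf n).sub hf₀)
  have hfg : ∀ {u : Vec N → ℝ}, MemLp u 2 (volOn (unitCube N)) →
      Integrable (fun y => u y * g y) (volOn (unitCube N)) := fun hu =>
    (MemLp.mul (r := 2) hg' hu).integrable one_le_two
  rw [← integral_sub (hfg (hf n)) (hfg hf₀)]
  simp only [← sub_mul]
  refine Real.le_sqrt_of_sq_le ?_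
  rw [Real.norm_eq_abs, sq_abs]
  refine (sq_integral_le hd).trans ?_
  rw [← integral_const_mul]
  refine integral_mono_ae hd.integrable_sq (((hf n).sub hf₀).integrable_sq.const_mul _) ?_
  filter_upwards [hgb] with y hy
  rw [Real.norm_eq_abs] at hy
  simp only [mul_pow]
  rw [mul_comm]
  exact mul_le_mul_of_nonneg_right (sq_le_sq' (neg_le_of_abs_le hy) (le_of_abs_le hy))
    (sq_nonneg _)

/-- By Fubini, convergence in `L²(Ω × Y)` means that the squared cell norms `d n` of the differences
tend to zero in `L¹(Ω)`, hence almost everywhere along a subsequence. The subsequence and the null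
set are fixed before `ψ` is chosen, so one null set serves all test functions. -/
theorem isClosed_divFreeL2 {N : ℕ} (Ω : Set (Vec N)) (ζ : Fin N → Vec N → ℝ) :
    IsClosed (divFreeL2 Ω ζ : Set (Fin N → L2Y Ω)) := by
  refine IsSeqClosed.isClosed fun v v₀ hv hlim => ?_
  set d : ℕ → Vec N → ℝ := fun n x => ∑ i, ∫ y in unitCube N, (v n i - v₀ i) (x, y) ^ 2
  have hdi : ∀ n i, Integrable (fun x => ∫ y in unitCube N, (v n i - v₀ i) (x, y) ^ 2)
      (volOn Ω) := fun n i => (Lp.memLp (v n i - v₀ i)).integrable_sq.integral_prod_left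
  have hd0 : ∀ n x, 0 ≤ d n x := fun n x =>
    Finset.sum_nonneg fun i _ => integral_nonneg fun y => sq_nonneg _
  have hdm : ∀ n, Integrable (d n) (volOn Ω) := fun n => integrable_finsetSum _ fun i _ => hdi n i
  have hint : ∀ n, ∫ x in Ω, d n x = ∑ i, ‖v n i - v₀ i‖ ^ 2 := by
    intro n
    rw [integral_finsetSum _ fun i _ => hdi n i]
    refine Finset.sum_congr rfl fun i _ => ?_
    rw [norm_L2_eq_sqrt, Real.sq_sqrt (integral_nonneg fun p => mul_self_nonneg _),
      ← integral_prod (fun p => (v n i - v₀ i) p ^ 2) (Lp.memLp (v n i - v₀ i)).integrable_sq]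
    simp only [sq]
  have hto : Tendsto (fun n => ∫ x in Ω, d n x) atTop (𝓝 0) := by
    simp only [hint]
    have : Tendsto (fun n => ∑ i, ‖v n i - v₀ i‖ ^ 2) atTop (𝓝 (∑ i : Fin N, (0 : ℝ) ^ 2)) :=
      tendsto_finsetSum _ fun i _ =>
        (tendsto_iff_norm_sub_tendsto_zero.1 ((tendsto_pi_nhds.1 hlim) i)).pow 2
    simpa using this
  have heL : Tendsto (fun n => eLpNorm (d n - 0) 1 (volOn Ω)) atTop (𝓝 0) := by
    have e : ∀ n, eLpNorm (d n - 0) 1 (volOn Ω) = ENNReal.ofReal (∫ x in Ω, d n x) := by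
      intro n
      rw [sub_zero, eLpNorm_one_eq_lintegral_enorm, ofReal_integral_eq_lintegral_ofReal (hdm n)
        (ae_of_all _ (hd0 n))]
      exact lintegral_congr fun x => Real.enorm_eq_ofReal (hd0 n x)
    simp only [e]
    simpa using ENNReal.tendsto_ofReal hto
  obtain ⟨ns, -, hns⟩ := (tendstoInMeasure_of_tendsto_eLpNorm one_ne_zero
    (fun n => (hdm n).1) aestronglyMeasurable_zero heL).exists_seq_tendsto_ae
  have hsub : ∀ᵐ x ∂(volOn Ω), ∀ n i, ∀ᵐ y ∂(volOn (unitCube N)),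
      (v n i - v₀ i) (x, y) = v n i (x, y) - v₀ i (x, y) :=
    ae_all_iff.2 fun n => ae_all_iff.2 fun i =>
      Measure.ae_ae_of_ae_prod (Lp.coeFn_sub (v n i) (v₀ i))
  have hvn : ∀ᵐ x ∂(volOn Ω), ∀ n, IsDivFree (fun i => ζ i x) fun i y => v n i (x, y) :=
    ae_all_iff.2 hv
  have hL1 : ∀ᵐ x ∂(volOn Ω), ∀ n i, MemLp (fun y => v n i (x, y)) 2 (volOn (unitCube N)) :=
    ae_all_iff.2 fun n => ae_all_iff.2 fun i => ae_memLp_section (v n i)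
  have hL0 : ∀ᵐ x ∂(volOn Ω), ∀ i, MemLp (fun y => v₀ i (x, y)) 2 (volOn (unitCube N)) :=
    ae_all_iff.2 fun i => ae_memLp_section (v₀ i)
  filter_upwards [hns, hsub, hvn, hL1, hL0] with x h1 h2 h3 h4 h5 ψ hψ hψp
  have hi : ∀ i, Tendsto (fun n => ∫ y in unitCube N, (v (ns n) i (x, y) - v₀ i (x, y)) ^ 2)
      atTop (𝓝 0) := by
    intro i
    refine squeeze_zero (fun n => integral_nonneg fun y => sq_nonneg _) (fun n => ?_) h1
    have e : ∫ y in unitCube N, (v (ns n) i (x, y) - v₀ i (x, y)) ^ 2 =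
        ∫ y in unitCube N, (v (ns n) i - v₀ i) (x, y) ^ 2 := by
      refine integral_congr_ae ?_
      filter_upwards [h2 (ns n) i] with y hy
      rw [hy]
    rw [e]
    exact Finset.single_le_sum
      (f := fun i => ∫ y in unitCube N, (v (ns n) i - v₀ i) (x, y) ^ 2)
      (fun i _ => integral_nonneg fun y => sq_nonneg _) (Finset.mem_univ i)
  have hlim2 : Tendsto (fun n => ∑ i, ζ i x * ∫ y in unitCube N, v (ns n) i (x, y) * partialD i ψ y)
      atTop (𝓝 (∑ i, ζ i x * ∫ y in unitCube N, v₀ i (x, y) * partialD i ψ y)) :=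
    tendsto_finsetSum _ fun i _ => (tendsto_integral_cell_mul (fun n => h4 (ns n) i) (h5 i)
      (hψ.partialD i).continuous (hi i)).const_mul _
  refine tendsto_nhds_unique hlim2 (tendsto_const_nhds.congr fun n => ?_)
  exact (h3 (ns n) ψ hψ hψp).symm

theorem norm_toL2Y_le {N : ℕ} {Ω : Set (Vec N)} (v : L2Cper Ω) : ‖toL2Y Ω v‖ ≤ ‖v‖ := by
  have h1 : MemLp (fun p : Vec N × Vec N => v p.1) 2 (volProd Ω) :=
    (Lp.memLp v).comp_fst (volOn (unitCube N))
  have h2 : eLpNorm (fun p : Vec N × Vec N => v p.1) 2 (volProd Ω) = eLpNorm v 2 (volOn Ω) :=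
    eLpNorm_comp_measurePreserving (Lp.aestronglyMeasurable v) measurePreserving_fst
  rw [Lp.norm_def, Lp.norm_def, ← h2]
  refine ENNReal.toReal_mono h1.2.ne (eLpNorm_mono_ae ?_)
  filter_upwards [coeFn_toL2Y v] with p hp
  rw [hp]
  exact abs_eval_le _ _

/-- The inclusion `L²(Ω; C_per(Y)) ⊂ L²(Ω × Y)` as a continuous linear map. -/
def toL2YL {N : ℕ} (Ω : Set (Vec N)) : L2Cper Ω →L[ℝ] L2Y Ω :=
  (toL2Y Ω).mkContinuous 1 fun v => by rw [one_mul]; exact norm_toL2Y_le v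

theorem isClosed_divFree {N : ℕ} (Ω : Set (Vec N)) (ζ : Fin N → Vec N → ℝ) :
    IsClosed (divFree Ω ζ : Set (Fin N → L2Cper Ω)) :=
  (isClosed_divFreeL2 Ω ζ).preimage
    (continuous_pi fun i => (toL2YL Ω).continuous.comp (continuous_apply i))

/-! ### Smooth approximation in `x` and in `y`. -/

/-- Smooth functions with compact support in `Ω`, as a subspace of `L²(Ω)`. -/
def smoothL2 {N : ℕ} (Ω : Set (Vec N)) : Submodule ℝ (L2 Ω) where
  carrier := {u | ∃ θ : Vec N → ℝ, ContDiff ℝ ∞ θ ∧ HasCompactSupport θ ∧ tsupport θ ⊆ Ω ∧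
    u =ᵐ[volOn Ω] θ}
  add_mem' := by
    rintro u v ⟨θ, h1, h2, h3, h4⟩ ⟨η, k1, k2, k3, k4⟩
    exact ⟨θ + η, h1.add k1, h2.add k2, (tsupport_add θ η).trans (union_subset h3 k3),
      (Lp.coeFn_add u v).trans (h4.add k4)⟩
  zero_mem' := ⟨0, contDiff_const, HasCompactSupport.zero, by simp [tsupport], Lp.coeFn_zero _ _ _⟩
  smul_mem' := by
    rintro c u ⟨θ, h1, h2, h3, h4⟩
    exact ⟨c • θ, contDiff_const.smul h1, h2.smul_left (f := fun _ => c),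
      (tsupport_smul_subset_right (fun _ => c) θ).trans h3,
      (Lp.coeFn_smul c u).trans (h4.const_smul c)⟩

/-- The orthogonal complement is trivial by the fundamental lemma of the calculus of variations. -/
theorem smoothL2_topologicalClosure {N : ℕ} {Ω : Set (Vec N)} (hΩ : IsOpen Ω) :
    (smoothL2 Ω).topologicalClosure = ⊤ := by
  rw [Submodule.topologicalClosure_eq_top_iff, Submodule.eq_bot_iff]
  intro u hu
  have hu' := (Submodule.mem_orthogonal _ _).1 hu
  have h0 : ∀ᵐ x ∂(volume : Measure (Vec N)), x ∈ Ω → u x = 0 := by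
    refine hΩ.ae_eq_zero_of_integral_contDiff_smul_eq_zero
      (locallyIntegrableOn_of_locallyIntegrable_restrict
        ((Lp.memLp u).locallyIntegrable one_le_two)) fun θ h1 h2 h3 => ?_
    have hm : MemLp θ 2 (volOn Ω) := h1.continuous.memLp_of_hasCompactSupport h2
    have := hu' hm.toLp ⟨θ, h1, h2, h3, hm.coeFn_toLp⟩
    rw [L2.inner_def] at this
    rw [← setIntegral_eq_integral_of_forall_compl_eq_zero (s := Ω)]
    · rw [← this]
      refine integral_congr_ae ?_
      filter_upwards [hm.coeFn_toLp] with x hx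
      rw [hx]
      simp [mul_comm]
    · intro x hx
      rw [image_eq_zero_of_notMem_tsupport fun h => hx (h3 h), zero_smul]
  refine Lp.ext ?_
  filter_upwards [(ae_restrict_iff' hΩ.measurableSet).2 h0, Lp.coeFn_zero ℝ 2 (volOn Ω)]
    with x h1 h2
  rw [h1, h2]
  rfl

theorem exists_smooth_eLpNorm_sub_le {N : ℕ} {Ω : Set (Vec N)} (hΩ : IsOpen Ω) {f : Vec N → ℝ}
    (hf : MemLp f 2 (volOn Ω)) {δ : ℝ} (hδ : 0 < δ) :
    ∃ θ : Vec N → ℝ, ContDiff ℝ ∞ θ ∧ HasCompactSupport θ ∧ tsupport θ ⊆ Ω ∧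
      eLpNorm (fun x => θ x - f x) 2 (volOn Ω) ≤ ENNReal.ofReal δ := by
  have hmem : hf.toLp ∈ (smoothL2 Ω).topologicalClosure := by
    rw [smoothL2_topologicalClosure hΩ]; trivial
  obtain ⟨u, ⟨θ, h1, h2, h3, h4⟩, hu⟩ := Metric.mem_closure_iff.1 hmem δ hδ
  refine ⟨θ, h1, h2, h3, ?_⟩
  rw [dist_comm, Lp.dist_def] at hu
  have e : eLpNorm (fun x => θ x - f x) 2 (volOn Ω) =
      eLpNorm (⇑u - ⇑hf.toLp) 2 (volOn Ω) := by
    refine eLpNorm_congr_ae ?_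
    filter_upwards [h4, hf.coeFn_toLp] with x k1 k2
    rw [Pi.sub_apply, k1, k2]
  rw [e, ← ENNReal.ofReal_toReal ((Lp.memLp u).sub (Lp.memLp hf.toLp)).eLpNorm_ne_top]
  exact ENNReal.ofReal_le_ofReal hu.le

theorem exists_pos_ofReal_mul_le {A ε : ℝ≥0∞} (hA : A ≠ ⊤) (hε : ε ≠ 0) :
    ∃ η : ℝ, 0 < η ∧ ENNReal.ofReal η * A ≤ ε := by
  have h : Tendsto (fun η : ℝ => ENNReal.ofReal η * A) (𝓝[>] 0) (𝓝 0) := by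
    have h1 := (ENNReal.tendsto_ofReal (tendsto_id (α := ℝ) (x := 𝓝 0))).mono_left
      (nhdsWithin_le_nhds (s := Ioi 0))
    have h2 := ENNReal.Tendsto.mul_const h1 (Or.inr hA)
    simpa using h2
  obtain ⟨η, h1, h2⟩ := ((h.eventually (ge_mem_nhds (pos_iff_ne_zero.2 hε))).and
    self_mem_nhdsWithin).exists
  exact ⟨η, h2, h1⟩

/-- Divergence free fields of `C_per(Y)^N`. -/
def divFreeCper (N : ℕ) : Submodule ℝ (Fin N → Cper N) where
  carrier := {c | IsDivFree (fun _ => 1) fun i => ((c i : Vec N →ᵇ ℝ) : Vec N → ℝ)}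
  add_mem' := by
    intro c d hc hd ψ hψ hψp
    rw [← add_zero (0 : ℝ)]
    nth_rewrite 1 [← hc ψ hψ hψp]
    rw [← hd ψ hψ hψp, ← Finset.sum_add_distrib]
    refine Finset.sum_congr rfl fun i _ => ?_
    have hi : ∀ e : Cper N,
        Integrable (fun y => (e : Vec N →ᵇ ℝ) y * partialD i ψ y) (volOn (unitCube N)) :=
      fun e => integrableOn_cell_of_continuous
        ((e : Vec N →ᵇ ℝ).continuous.mul (hψ.partialD i).continuous)
    rw [← mul_add, ← integral_add (hi _) (hi _)]
    simp only [← add_mul]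
    rfl
  zero_mem' := by
    intro ψ _ _
    simp
  smul_mem' := by
    intro r c hc ψ hψ hψp
    rw [← mul_zero r, ← hc ψ hψ hψp, Finset.mul_sum]
    refine Finset.sum_congr rfl fun i _ => ?_
    rw [mul_left_comm, ← integral_const_mul r]
    refine congrArg ((1 : ℝ) * ·) (integral_congr_ae (ae_of_all _ fun y => ?_))
    exact mul_assoc r ((c i : Vec N →ᵇ ℝ) y) (partialD i ψ y)

theorem unitCube_ae_eq_Icc {N : ℕ} : unitCube N =ᵐ[volume] Icc (0 : Vec N) 1 := by
  rw [unitCube, volume_pi]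
  exact Measure.univ_pi_Ioo_ae_eq_Icc

theorem continuous_integral_cell {N : ℕ} {T : Type} [TopologicalSpace T]
    [FirstCountableTopology T] [LocallyCompactSpace T] {F : T → Vec N → ℝ} (hF : Continuous (Function.uncurry F)) :
    Continuous fun t => ∫ y in unitCube N, F t y := by
  simp only [setIntegral_congr_set unitCube_ae_eq_Icc]
  exact continuous_parametric_integral_of_continuous hF isCompact_Icc

/-- Convolution of a continuous periodic function with a smooth bump. -/
def mollify {N : ℕ} (φ : ContDiffBump (0 : Vec N)) (c : Cper N) : Vec N → ℝ :=
  convolution (φ.normed volume) (c : Vec N →ᵇ ℝ) (ContinuousLinearMap.lsmul ℝ ℝ) volume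

theorem mollify_apply {N : ℕ} (φ : ContDiffBump (0 : Vec N)) (c : Cper N) (x : Vec N) :
    mollify φ c x = ∫ t, φ.normed volume t * (c : Vec N →ᵇ ℝ) (x - t) := rfl

theorem contDiff_mollify {N : ℕ} (φ : ContDiffBump (0 : Vec N)) (c : Cper N) :
    ContDiff ℝ ∞ (mollify φ c) :=
  φ.hasCompactSupport_normed.contDiff_convolution_left _ φ.contDiff_normed
    (c : Vec N →ᵇ ℝ).continuous.locallyIntegrable

theorem isYPeriodic_mollify {N : ℕ} (φ : ContDiffBump (0 : Vec N)) (c : Cper N) :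
    IsYPeriodic (mollify φ c) := by
  intro k y
  simp only [mollify_apply]
  congr 1
  ext t
  have := c.2 k (y - t)
  rw [← this]
  congr 2
  abel

/-- Fubini and a shift of the cell move the convolution onto the test function, and each translate
`ψ(· + t)` is again smooth and periodic. -/
theorem isDivFree_mollify {N : ℕ} (φ : ContDiffBump (0 : Vec N)) {c : Fin N → Cper N}
    (hc : c ∈ divFreeCper N) : IsDivFree (fun _ => 1) fun i => mollify φ (c i) := by
  intro ψ hψ hψp
  set g : Vec N → ℝ := φ.normed volume
  have hg : Continuous g := φ.continuous_normed
  have hgi : Integrable g := φ.integrable_normed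
  have key : ∀ i, ∫ y in unitCube N, mollify φ (c i) y * partialD i ψ y =
      ∫ t, g t * ∫ y in unitCube N,
        (c i : Vec N →ᵇ ℝ) y * partialD i (fun z => ψ (z + t)) y := by
    intro i
    have hp : Continuous (partialD i ψ) := (hψ.partialD i).continuous
    simp only [mollify_apply, ← integral_mul_const]
    rw [integral_integral_swap]
    · refine integral_congr_ae (ae_of_all _ fun t => ?_)
      dsimp only
      rw [← integral_const_mul]
      have hper : IsYPeriodic fun y => g t * (c i : Vec N →ᵇ ℝ) (y - t) * partialD i ψ y := by
        intro k y
        have h1 := (IsYPeriodic.comp_add (c i).2 (-t)) k y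
        simp only [← sub_eq_add_neg] at h1
        simp only [h1, (hψp.partialD i) k y]
      rw [← setIntegral_unitCube_add hper t]
      refine integral_congr_ae (ae_of_all _ fun y => ?_)
      simp only [partialD, add_sub_cancel_right, fderiv_comp_add_right, mul_assoc, g]
    · have h1 : Integrable (fun p : Vec N × Vec N => partialD i ψ p.1 * g p.2)
          ((volOn (unitCube N)).prod volume) :=
        (integrableOn_cell_of_continuous hp).mul_prod hgi
      refine (h1.norm.const_mul ‖c i‖).mono (Continuous.aestronglyMeasurable ?_)
        (ae_of_all _ fun p => ?_)
      · have := (c i : Vec N →ᵇ ℝ).continuous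
        change Continuous fun p : Vec N × Vec N =>
          g p.2 * (c i : Vec N →ᵇ ℝ) (p.1 - p.2) * partialD i ψ p.1
        fun_prop
      · simp only [Function.uncurry, norm_mul, norm_norm]
        have := abs_eval_le (c i) (p.1 - p.2)
        calc _ = ‖(c i : Vec N →ᵇ ℝ) (p.1 - p.2)‖ * (‖partialD i ψ p.1‖ * ‖g p.2‖) := by ring
          _ ≤ _ := by gcongr
  simp only [key, one_mul]
  rw [← integral_finsetSum]
  · simp only [← Finset.mul_sum]
    refine integral_eq_zero_of_ae (ae_of_all _ fun t => ?_)
    have := hc (fun z => ψ (z + t)) (hψ.comp (by fun_prop)) (hψp.comp_add t)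
    simp only [one_mul] at this
    simp [this]
  · intro i _
    have hcont : Continuous fun t => ∫ y in unitCube N,
        (c i : Vec N →ᵇ ℝ) y * partialD i (fun z => ψ (z + t)) y := by
      simp only [partialD, fderiv_comp_add_right]
      have hp : Continuous (partialD i ψ) := (hψ.partialD i).continuous
      change Continuous fun t => ∫ y in unitCube N, (c i : Vec N →ᵇ ℝ) y * partialD i ψ (y + t)
      refine continuous_integral_cell ?_
      have := (c i : Vec N →ᵇ ℝ).continuous
      unfold Function.uncurry
      fun_prop
    exact (hg.mul hcont).integrable_of_hasCompactSupport
      (φ.hasCompactSupport_normed.mul_right)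

theorem exists_smooth_mem_divFreeCper {N : ℕ} {c : Fin N → Cper N} (hc : c ∈ divFreeCper N)
    {ε : ℝ} (hε : 0 < ε) :
    ∃ d ∈ divFreeCper N, (∀ i, ContDiff ℝ ∞ (d i : Vec N →ᵇ ℝ)) ∧ ‖c - d‖ ≤ ε := by
  have hu : ∀ i, ∃ δ > 0, ∀ {x y : Vec N}, dist x y < δ →
      dist ((c i : Vec N →ᵇ ℝ) x) ((c i : Vec N →ᵇ ℝ) y) < ε := fun i =>
    Metric.uniformContinuous_iff.1 (Cper.uniformContinuous (c i)) ε hε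
  choose δ hδ h using hu
  obtain ⟨r, hr, hrδ⟩ : ∃ r > 0, ∀ i, r ≤ δ i := by
    rcases isEmpty_or_nonempty (Fin N) with hN | hN
    · exact ⟨1, one_pos, fun i => hN.elim i⟩
    · obtain ⟨i₀, hi₀⟩ := Finite.exists_min δ
      exact ⟨δ i₀, hδ i₀, hi₀⟩
  -- The support radius `r` is below every modulus of continuity `δ i`, so averaging over it moves
  -- each component by at most `ε`.
  set φ : ContDiffBump (0 : Vec N) := ⟨r / 2, r, half_pos hr, half_lt_self hr⟩
  refine ⟨fun i => Cper.mk (mollify φ (c i)) (contDiff_mollify φ (c i)).continuous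
    (isYPeriodic_mollify φ (c i)), isDivFree_mollify φ hc, fun i => contDiff_mollify φ (c i), ?_⟩
  rw [pi_norm_le_iff_of_nonneg hε.le]
  intro i
  refine Cper.norm_le _ hε.le fun y => ?_
  have := φ.dist_normed_convolution_le (μ := volume) (x₀ := y) (g := (c i : Vec N →ᵇ ℝ)) (ε := ε)
    (c i : Vec N →ᵇ ℝ).continuous.aestronglyMeasurable
    (fun x hx => (h i (lt_of_lt_of_le hx (hrδ i))).le)
  rw [dist_comm] at this
  exact this

theorem isTest_mul {N : ℕ} {Ω : Set (Vec N)} {θ c : Vec N → ℝ} (h1 : ContDiff ℝ ∞ θ)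
    (h2 : HasCompactSupport θ) (h3 : tsupport θ ⊆ Ω) (hc : ContDiff ℝ ∞ c) (hp : IsYPeriodic c) :
    IsTest Ω fun x y => θ x * c y := by
  refine ⟨(h1.comp contDiff_fst).mul (hc.comp contDiff_snd), fun x k y => ?_, tsupport θ, h2, h3,
    fun x hx y => ?_⟩
  · simp only [hp k y]
  · simp only [image_eq_zero_of_notMem_tsupport hx, zero_mul]

theorem IsTest.add {N : ℕ} {Ω : Set (Vec N)} {φ χ : Vec N → Vec N → ℝ} (hφ : IsTest Ω φ)
    (hχ : IsTest Ω χ) : IsTest Ω fun x y => φ x y + χ x y := by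
  obtain ⟨h1, h2, K, hK, hKΩ, h3⟩ := hφ
  obtain ⟨k1, k2, L, hL, hLΩ, k3⟩ := hχ
  refine ⟨h1.add k1, fun x k y => ?_, K ∪ L, hK.union hL, union_subset hKΩ hLΩ, fun x hx y => ?_⟩
  · simp only [h2 x k y, k2 x k y]
  · rw [mem_union, not_or] at hx
    simp only [h3 x hx.1 y, k3 x hx.2 y, add_zero]

/-! ### Density in `X^N` for unit weights. -/

theorem exists_test_approx_indicator {N : ℕ} {Ω : Set (Vec N)} (hΩ : IsOpen Ω)
    (c : divFreeCper N) {s : Set (Vec N)} (hs : MeasurableSet s) (hμ : volOn Ω s < ⊤) {ε : ℝ≥0∞}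
    (hε : ε ≠ 0) :
    ∃ g : Vec N → divFreeCper N, eLpNorm (g - s.indicator fun _ => c) 2 (volOn Ω) ≤ ε ∧
      ∃ φ : Fin N → Vec N → Vec N → ℝ, (∀ i, IsTest Ω (φ i)) ∧
        ∀ x i y, ((g x).1 i : Vec N →ᵇ ℝ) y = φ i x y := by
  have hε2 : ε / 2 ≠ 0 := by simpa using hε
  have hA : volOn Ω s ^ (1 / (2 : ℝ≥0∞).toReal) ≠ ⊤ :=
    ENNReal.rpow_ne_top_of_nonneg (by positivity) hμ.ne
  -- The error splits as `(θ - 1_s) d + 1_s (d - c)`. Here `η` bounds `‖c - d‖` so that the second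
  -- part is at most `ε/2`; afterwards `δ`, which depends on `d`, does the same for the first.
  obtain ⟨η, hη, hη'⟩ := exists_pos_ofReal_mul_le hA hε2
  obtain ⟨d, hd, hds, hcd⟩ := exists_smooth_mem_divFreeCper c.2 hη
  set d' : divFreeCper N := ⟨d, hd⟩
  obtain ⟨δ, hδ, hδ'⟩ := exists_pos_ofReal_mul_le (A := ‖d'‖ₑ) enorm_ne_top hε2
  have hind : MemLp (s.indicator fun _ => (1 : ℝ)) 2 (volOn Ω) :=
    memLp_indicator_const 2 hs 1 (Or.inr hμ.ne)
  obtain ⟨θ, h1, h2, h3, h4⟩ := exists_smooth_eLpNorm_sub_le hΩ hind hδ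
  refine ⟨fun x => θ x • d', ?_, fun i x y => θ x * (d i : Vec N →ᵇ ℝ) y,
    fun i => isTest_mul h1 h2 h3 (hds i) (d i).2, fun x i y => rfl⟩
  have hsplit : (fun x => θ x • d') - s.indicator (fun _ => c) =
      (fun x => (θ x - s.indicator (fun _ => (1 : ℝ)) x) • d') + s.indicator fun _ => d' - c := by
    ext1 x
    by_cases hx : x ∈ s
    · simp only [Pi.sub_apply, Pi.add_apply, indicator_of_mem hx]
      refine Subtype.ext (funext fun i => Cper.ext_apply fun y => ?_)
      change θ x * (d i : Vec N →ᵇ ℝ) y - (c.1 i : Vec N →ᵇ ℝ) y =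
        (θ x - 1) * (d i : Vec N →ᵇ ℝ) y + ((d i : Vec N →ᵇ ℝ) y - (c.1 i : Vec N →ᵇ ℝ) y)
      ring
    · simp [hx]
  have hθm : AEStronglyMeasurable (fun x => θ x - s.indicator (fun _ => (1 : ℝ)) x) (volOn Ω) :=
    h1.continuous.aestronglyMeasurable.sub hind.1
  rw [hsplit, ← ENNReal.add_halves ε]
  refine (eLpNorm_add_le (hθm.smul_const d')
    (aestronglyMeasurable_const.indicator hs) one_le_two).trans (add_le_add ?_ ?_)
  · refine le_trans ?_ hδ'
    refine (eLpNorm_le_mul_eLpNorm_of_ae_le_mul' (c := ‖d'‖₊) (g := fun x =>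
      θ x - s.indicator (fun _ => (1 : ℝ)) x) (ae_of_all _ fun x => ?_) 2).trans ?_
    · rw [enorm_smul, mul_comm]; rfl
    · rw [mul_comm]
      exact mul_le_mul_left h4 _
  · have e := eLpNorm_indicator_const (μ := volOn Ω) (c := d' - c) (p := 2) hs two_ne_zero
      ENNReal.ofNat_ne_top
    rw [e]
    refine le_trans (mul_le_mul_left ?_ _) hη'
    rw [← ofReal_norm, norm_sub_rev]
    exact ENNReal.ofReal_le_ofReal hcd

/-- With unit weights the constraint on the slices does not depend on `x`, so an element is an `L²`
map into `divFreeCper N`. Approximating inside this space keeps every approximant divergence free,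
and simple functions reduce the task to `exists_test_approx_indicator`. -/
theorem divFree_one_subset_closure {N : ℕ} {Ω : Set (Vec N)} (hΩ : IsOpen Ω) :
    (divFree Ω (fun _ _ => 1) : Set (Fin N → L2Cper Ω)) ⊆
      closure ((divFree Ω (fun _ _ => 1) : Set (Fin N → L2Cper Ω)) ∩
        smoothElements Ω (toL2Y Ω)) := by
  classical
  intro v hv
  have hv' : ∀ᵐ x ∂(volOn Ω), (fun i => v i x) ∈ divFreeCper N :=
    (mem_divFree_iff fun i => EventuallyEq.rfl).1 hv
  -- The value `0` on the exceptional null set makes `F` take values in the subspace at every point.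
  set F : Vec N → divFreeCper N := fun x =>
    if h : (fun i => v i x) ∈ divFreeCper N then ⟨_, h⟩ else 0
  have hFv : ∀ᵐ x ∂(volOn Ω), ∀ i, (F x).1 i = v i x := by
    filter_upwards [hv'] with x hx i
    simp only [F, dif_pos hx]
  have hFm : MemLp (fun x => (F x).1) 2 (volOn Ω) := by
    refine MemLp.of_eval fun i => (Lp.memLp (v i)).ae_eq ?_
    filter_upwards [hFv] with x hx
    exact (hx i).symm
  have hF : MemLp F 2 (volOn Ω) :=
    (memLp_norm_iff (Topology.IsEmbedding.subtypeVal.aestronglyMeasurable_comp_iff.1 hFm.1)).1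
      hFm.norm
  refine Metric.mem_closure_iff.2 fun ε hε => ?_
  have hε2 : ENNReal.ofReal (ε / 2) ≠ 0 := by simpa using hε
  obtain ⟨G, hG, hGm, φ, hφ, hGφ⟩ := hF.induction_dense ENNReal.ofNat_ne_top
    (fun G => AEStronglyMeasurable G (volOn Ω) ∧ ∃ φ : Fin N → Vec N → Vec N → ℝ,
      (∀ i, IsTest Ω (φ i)) ∧ ∀ x i y, ((G x).1 i : Vec N →ᵇ ℝ) y = φ i x y)
    (fun c s hs hμ ε hε => by
      obtain ⟨g, h1, φ, h2, h3⟩ := exists_test_approx_indicator hΩ c hs hμ hε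
      refine ⟨g, h1, ?_, φ, h2, h3⟩
      refine Topology.IsEmbedding.subtypeVal.aestronglyMeasurable_comp_iff.1 ?_
      refine (MemLp.of_eval (p := 2) fun i => ?_).1
      have : (fun x => (g x).1 i) = (h2 i).curried := by
        ext1 x
        exact Cper.ext_apply (h3 x i)
      exact this ▸ (h2 i).memLp_curried)
    (by
      rintro f g ⟨h1, φ, h2, h3⟩ ⟨k1, χ, k2, k3⟩
      refine ⟨h1.add k1, _, fun i => (h2 i).add (k2 i), fun x i y => ?_⟩
      rw [← h3, ← k3]
      rfl)
    (fun f hf => hf.1) hε2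
  have hGc : ∀ i, (fun x => (G x).1 i) = (hφ i).curried := fun i => by
    ext1 x
    exact Cper.ext_apply (hGφ x i)
  have hGi : ∀ i, MemLp (fun x => (G x).1 i) 2 (volOn Ω) := fun i =>
    (hGc i) ▸ (hφ i).memLp_curried
  refine ⟨fun i => (hGi i).toLp, ⟨?_, φ, fun i => ⟨hφ i, ?_⟩⟩, ?_⟩
  · exact (mem_divFree_iff fun i => (hGi i).coeFn_toLp).2 (ae_of_all _ fun x => (G x).2)
  · refine (toL2Y_ae_eq (hGi i).coeFn_toLp).trans (ae_of_all _ fun p => ?_)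
    exact hGφ _ _ _
  · refine lt_of_le_of_lt ?_ (half_lt_self hε)
    refine (dist_pi_le_iff (half_pos hε).le).2 fun i => ?_
    rw [Lp.dist_def]
    refine ENNReal.toReal_le_of_le_ofReal (half_pos hε).le (le_trans (eLpNorm_mono_ae ?_) hG)
    filter_upwards [hFv, (hGi i).coeFn_toLp] with x h1 h2
    rw [Pi.sub_apply, Pi.sub_apply, h2, ← h1 i]
    exact norm_le_pi_norm (F x - G x).1 i

/-! ### Change of weights by multiplication. -/

/-- Multiplication by an essentially bounded function on `L²`. -/
def mulLp {T : Type} [MeasurableSpace T] {μ : Measure T} (E : Type) [NormedAddCommGroup E]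
    [NormedSpace ℝ E] {m : T → ℝ} (hm : MemLp m ⊤ μ) : Lp E 2 μ →L[ℝ] Lp E 2 μ :=
  LinearMap.mkContinuous
    { toFun := fun v => (hm.toLp • v : Lp E 2 μ)
      map_add' := fun v w => Lp.add_smul _ v w
      map_smul' := fun c v => (Lp.smul_comm c hm.toLp v).symm }
    ‖hm.toLp‖ fun v => Lp.norm_smul_le _ v

theorem coeFn_mulLp {T : Type} [MeasurableSpace T] {μ : Measure T} {E : Type}
    [NormedAddCommGroup E] [NormedSpace ℝ E] {m : T → ℝ} (hm : MemLp m ⊤ μ) (v : Lp E 2 μ) :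
    mulLp E hm v =ᵐ[μ] fun x => m x • v x := by
  filter_upwards [Lp.coeFn_lpSMul (r := 2) hm.toLp v, hm.coeFn_toLp] with x h1 h2
  change (hm.toLp • v : Lp E 2 μ) x = _
  rw [h1, Pi.smul_apply', h2]

theorem isDivFree_mul_iff {N : ℕ} {ζ m : Fin N → ℝ} {e : Fin N → Vec N → ℝ} :
    IsDivFree ζ (fun i y => m i * e i y) ↔ IsDivFree (fun i => ζ i * m i) e := by
  unfold IsDivFree
  simp only [mul_assoc, integral_const_mul]

theorem mulLp_mem_divFreeL2 {N : ℕ} {Ω : Set (Vec N)} {ζ ξ m : Fin N → Vec N → ℝ}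
    (hm : ∀ i, MemLp (fun p : Vec N × Vec N => m i p.1) ⊤ (volProd Ω))
    (h : ∀ᵐ x ∂(volOn Ω), ∀ i, ξ i x * m i x = ζ i x) {v : Fin N → L2Y Ω}
    (hv : v ∈ divFreeL2 Ω ζ) : (fun i => mulLp ℝ (hm i) (v i)) ∈ divFreeL2 Ω ξ := by
  rw [ae_isDivFree_iff (φ := fun i x y => m i x * v i (x, y)) fun i => coeFn_mulLp (hm i) (v i)]
  filter_upwards [mem_divFreeL2.1 hv, h] with x h1 h2
  rw [isDivFree_mul_iff]
  simpa only [h2] using h1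

theorem mulLp_mem_divFree {N : ℕ} {Ω : Set (Vec N)} {ζ ξ m : Fin N → Vec N → ℝ}
    (hm : ∀ i, MemLp (m i) ⊤ (volOn Ω))
    (h : ∀ᵐ x ∂(volOn Ω), ∀ i, ξ i x * m i x = ζ i x) {v : Fin N → L2Cper Ω}
    (hv : v ∈ divFree Ω ζ) : (fun i => mulLp (Cper N) (hm i) (v i)) ∈ divFree Ω ξ := by
  rw [mem_divFree_iff (f := fun i x => m i x • v i x) fun i => coeFn_mulLp (hm i) (v i)]
  filter_upwards [(mem_divFree_iff fun i => EventuallyEq.rfl).1 hv, h] with x h1 h2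
  have := isDivFree_mul_iff (ζ := fun i => ξ i x) (m := fun i => m i x)
    (e := fun i => ((v i x : Vec N →ᵇ ℝ) : Vec N → ℝ))
  refine this.2 ?_
  simpa only [h2] using h1

theorem toL2Y_mulLp {N : ℕ} {Ω : Set (Vec N)} {m : Vec N → ℝ} (hm : MemLp m ⊤ (volOn Ω))
    (hm' : MemLp (fun p : Vec N × Vec N => m p.1) ⊤ (volProd Ω)) (v : L2Cper Ω) :
    toL2Y Ω (mulLp (Cper N) hm v) = mulLp ℝ hm' (toL2Y Ω v) := by
  refine Lp.ext ?_
  filter_upwards [toL2Y_ae_eq (coeFn_mulLp hm v), coeFn_mulLp hm' (toL2Y Ω v), coeFn_toL2Y v]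
    with p h1 h2 h3
  rw [h1, h2, h3]
  rfl

/-- Smoothness of `m` is needed only in `Ω`: a point outside `Ω` has a neighbourhood disjoint from
the compact support in `x`, where the product is zero. -/
theorem IsTest.mul_left {N : ℕ} {Ω : Set (Vec N)} (hΩ : IsOpen Ω) {φ : Vec N → Vec N → ℝ}
    (hφ : IsTest Ω φ) {m : Vec N → ℝ} (hm : ContDiffOn ℝ ∞ m Ω) :
    IsTest Ω fun x y => m x * φ x y := by
  obtain ⟨h1, h2, K, hK, hKΩ, h3⟩ := hφ
  refine ⟨contDiff_iff_contDiffAt.2 fun p => ?_, fun x k y => by simp only [h2 x k y], K, hK, hKΩ,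
    fun x hx y => by simp only [h3 x hx y, mul_zero]⟩
  by_cases hp : p.1 ∈ Ω
  · exact (((hm p.1 hp).contDiffAt (hΩ.mem_nhds hp)).comp p contDiffAt_fst).mul h1.contDiffAt
  · have hpK : p.1 ∉ K := fun h => hp (hKΩ h)
    refine (contDiffAt_const (c := (0 : ℝ))).congr_of_eventuallyEq ?_
    have : ∀ᶠ q : Vec N × Vec N in 𝓝 p, q.1 ∈ Kᶜ :=
      continuous_fst.continuousAt.eventually (hK.isClosed.isOpen_compl.mem_nhds hpK)
    filter_upwards [this] with q hq
    rw [h3 q.1 hq, mul_zero]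

theorem mulLp_mulLp {T : Type} [MeasurableSpace T] {μ : Measure T} {E : Type}
    [NormedAddCommGroup E] [NormedSpace ℝ E] {m n : T → ℝ} (hm : MemLp m ⊤ μ) (hn : MemLp n ⊤ μ)
    (h : ∀ᵐ x ∂μ, n x * m x = 1) (v : Lp E 2 μ) : mulLp E hn (mulLp E hm v) = v := by
  refine Lp.ext ?_
  filter_upwards [coeFn_mulLp hn (mulLp E hm v), coeFn_mulLp hm v, h] with x h1 h2 h3
  rw [h1, h2, smul_smul, h3, one_smul]

/-- Multiplication by `ζ` maps the space to the one with unit weights, and multiplication by `ξ =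
1/ζ` maps it back continuously, preserving both the constraint and the test functions; density is
carried over. -/
theorem divFree_subset_closure {N : ℕ} {Ω : Set (Vec N)} (hΩ : IsOpen Ω)
    {ζ ξ : Fin N → Vec N → ℝ} (hζ : ∀ i, MemLp (ζ i) ⊤ (volOn Ω))
    (hξ : ∀ i, MemLp (ξ i) ⊤ (volOn Ω)) (hξs : ∀ i, ContDiffOn ℝ ∞ (ξ i) Ω)
    (h : ∀ᵐ x ∂(volOn Ω), ∀ i, ξ i x * ζ i x = 1) :
    (divFree Ω ζ : Set (Fin N → L2Cper Ω)) ⊆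
      closure ((divFree Ω ζ : Set (Fin N → L2Cper Ω)) ∩ smoothElements Ω (toL2Y Ω)) := by
  intro v hv
  have hw : (fun i => mulLp (Cper N) (hζ i) (v i)) ∈ divFree Ω (fun _ _ => 1) :=
    mulLp_mem_divFree hζ (ae_of_all _ fun x i => one_mul _) hv
  have hT : Continuous fun (w : Fin N → L2Cper Ω) i => mulLp (Cper N) (hξ i) (w i) :=
    continuous_pi fun i => (mulLp (Cper N) (hξ i)).continuous.comp (continuous_apply i)
  have hv' : (fun i => mulLp (Cper N) (hξ i) (mulLp (Cper N) (hζ i) (v i))) = v :=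
    funext fun i => mulLp_mulLp (hζ i) (hξ i) (h.mono fun x hx => hx i) (v i)
  rw [← hv']
  refine map_mem_closure hT (divFree_one_subset_closure hΩ hw) ?_
  rintro w ⟨h1, φ, h2⟩
  refine ⟨mulLp_mem_divFree hξ ?_ h1, fun i x y => ξ i x * φ i x y, fun i =>
    ⟨(h2 i).1.mul_left hΩ (hξs i), ?_⟩⟩
  · filter_upwards [h] with x hx i
    rw [mul_comm, hx]
  · rw [toL2Y_mulLp (hξ i) ((hξ i).comp_fst _)]
    filter_upwards [coeFn_mulLp ((hξ i).comp_fst (volOn (unitCube N))) (toL2Y Ω (w i)), (h2 i).2]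
      with p k1 k2
    rw [k1, k2]
    rfl

/-! ### Density in `L²(Ω × Y)^N` by duality. -/

theorem isYPeriodic_comp_infEDist {N : ℕ} {S : Set (Vec N)}
    (hS : ∀ k : Fin N → ℤ, (fun y : Vec N => y + fun i => (k i : ℝ)) '' S = S)
    (F : ℝ≥0∞ → ℝ) : IsYPeriodic fun y => F (Metric.infEDist y S) := by
  intro k y
  dsimp only
  have h := Metric.infEDist_image (x := y) (t := S)
    (isometry_add_right (fun i => (k i : ℝ) : Vec N))
  rw [hS k] at h
  rw [h]

open scoped Pointwise in
-- It suffices that `e` has zero integral over closed sets `K`. The periodised set `S` is closed and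
-- meets the open cell exactly in `K`; its thickened indicators depend only on the distance to `S`,
-- so they are continuous and periodic, and they decrease the problem to dominated convergence.
theorem ae_eq_zero_of_forall_integral_Cper_mul {N : ℕ} {e : Vec N → ℝ}
    (he : Integrable e (volOn (unitCube N)))
    (h : ∀ ψ : Cper N, ∫ y in unitCube N, (ψ : Vec N →ᵇ ℝ) y * e y = 0) :
    ∀ᵐ y ∂(volOn (unitCube N)), e y = 0 := by
  refine ae_eq_zero_of_forall_setIntegral_isClosed_eq_zero he fun K hK => ?_
  set Z : Set (Vec N) := Set.univ.pi fun _ => Set.range ((↑) : ℤ → ℝ)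
  have hZ : IsClosed Z :=
    isClosed_set_pi fun _ _ => Int.isClosedEmbedding_coe_real.isClosed_range
  set S : Set (Vec N) := (K ∩ Set.Icc 0 1) + Z
  have hSc : IsClosed S := hZ.add_left_of_isCompact (isCompact_Icc.inter_left hK)
  have hSp : ∀ k : Fin N → ℤ, (fun y : Vec N => y + fun i => (k i : ℝ)) '' S = S := by
    have hsub : ∀ k : Fin N → ℤ, (fun y : Vec N => y + fun i => (k i : ℝ)) '' S ⊆ S := by
      rintro k _ ⟨_, ⟨c, hc, z, hz, rfl⟩, rfl⟩
      refine ⟨c, hc, z + fun i => (k i : ℝ), fun i hi => ?_, (add_assoc _ _ _).symm⟩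
      obtain ⟨n, hn⟩ := hz i hi
      exact ⟨n + k i, by simp [← hn]⟩
    intro k
    refine (hsub k).antisymm fun y hy => ?_
    refine ⟨y + fun i => ((-k) i : ℝ), hsub (-k) ⟨y, hy, by simp⟩, ?_⟩
    ext i
    simp
  have hmem : ∀ y ∈ unitCube N, (y ∈ S ↔ y ∈ K) := by
    intro y hy
    constructor
    · rintro ⟨c, ⟨hcK, hc0, hc1⟩, z, hz, rfl⟩
      -- Since `y` lies in the open cell and `c` in the closed one, each integer `z i` lies strictly
      -- between `-1` and `1`.
      have : z = 0 := by
        ext i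
        obtain ⟨n, hn⟩ := hz i (mem_univ i)
        have h1 := hy i (mem_univ i)
        simp only [Pi.add_apply, ← hn] at h1
        have h2 : (0 : ℝ) ≤ c i := hc0 i
        have h3 : c i ≤ (1 : ℝ) := hc1 i
        have h4 : (n : ℝ) < 1 := by linarith [h1.2]
        have h5 : (-1 : ℝ) < n := by linarith [h1.1]
        have h6 : n = 0 := by
          have : n < 1 := by exact_mod_cast h4
          have : -1 < n := by exact_mod_cast h5
          omega
        simp [← hn, h6]
      rw [this]
      simpa using hcK
    · intro hK'
      refine ⟨y, ⟨hK', ?_⟩, 0, fun i _ => ⟨0, by simp⟩, by simp⟩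
      exact closure_unitCube (N := N) ▸ subset_closure hy
  have hδ : ∀ n : ℕ, 0 < 1 / ((n : ℝ) + 1) := fun n => by positivity
  set ψ : ℕ → Cper N := fun n => Cper.mk (fun y => (thickenedIndicator (hδ n) S y : ℝ))
    (NNReal.continuous_coe.comp (thickenedIndicator (hδ n) S).continuous)
    (isYPeriodic_comp_infEDist hSp fun d => (((1 - d / ENNReal.ofReal _ : ℝ≥0∞)).toNNReal : ℝ))
  have hψ1 : ∀ n y, ‖(ψ n : Vec N →ᵇ ℝ) y‖ ≤ 1 := by
    intro n y
    change ‖(thickenedIndicator (hδ n) S y : ℝ)‖ ≤ 1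
    rw [Real.norm_of_nonneg (NNReal.coe_nonneg _)]
    exact_mod_cast thickenedIndicator_le_one (hδ n) S y
  have hlim := thickenedIndicator_tendsto_indicator_closure hδ
    tendsto_one_div_add_atTop_nhds_zero_nat S
  rw [hSc.closure_eq, tendsto_pi_nhds] at hlim
  have hdom : Tendsto (fun n => ∫ y in unitCube N, (ψ n : Vec N →ᵇ ℝ) y * e y) atTop
      (𝓝 (∫ y in unitCube N, K.indicator e y)) := by
    refine tendsto_integral_of_dominated_convergence (fun y => ‖e y‖)
      (fun n => (ψ n : Vec N →ᵇ ℝ).continuous.aestronglyMeasurable.mul he.1) he.norm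
      (fun n => ae_of_all _ fun y => ?_) ?_
    · rw [norm_mul]
      exact mul_le_of_le_one_left (norm_nonneg _) (hψ1 n y)
    · filter_upwards [ae_restrict_mem measurableSet_unitCube] with y hy
      have h1 : Tendsto (fun n => (ψ n : Vec N →ᵇ ℝ) y) atTop
          (𝓝 ((S.indicator (fun _ => (1 : NNReal)) y : NNReal) : ℝ)) :=
        (NNReal.continuous_coe.tendsto _).comp (hlim y)
      have h2 := h1.mul_const (e y)
      have h3 : ((S.indicator (fun _ => (1 : NNReal)) y : NNReal) : ℝ) * e y =
          K.indicator e y := by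
        by_cases hyK : y ∈ K
        · simp [hyK, (hmem y hy).2 hyK]
        · simp [hyK, mt (hmem y hy).1 hyK]
      rwa [h3] at h2
  rw [← integral_indicator hK.measurableSet]
  refine tendsto_nhds_unique hdom (tendsto_const_nhds.congr fun n => ?_)
  exact (h (ψ n)).symm

/-- The hypothesis gives zero integral over rectangles, and a π-λ argument extends this to all
measurable sets. -/
theorem ae_eq_zero_of_forall_setIntegral_section {S T : Type} [MeasurableSpace S]
    [MeasurableSpace T] {μ : Measure S} {ν : Measure T} [SFinite μ] [SFinite ν] {r : S × T → ℝ}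
    (hr : Integrable r (μ.prod ν))
    (h : ∀ A, MeasurableSet A → ∀ᵐ y ∂ν, ∫ x in A, r (x, y) ∂μ = 0) :
    r =ᵐ[μ.prod ν] 0 := by
  refine hr.ae_eq_zero_of_forall_setIntegral_eq_zero fun s hs hfin => ?_
  -- The induction runs over all measurable sets, as finiteness of measure need not survive
  -- complements.
  clear hfin
  have hrect : ∀ A, MeasurableSet A → ∀ B, MeasurableSet B →
      ∫ p in A ×ˢ B, r p ∂(μ.prod ν) = 0 := by
    intro A hA B hB
    rw [← Measure.prod_restrict, integral_prod_symm]
    · refine integral_eq_zero_of_ae ?_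
      exact ae_restrict_of_ae (h A hA)
    · rw [Measure.prod_restrict]
      exact hr.restrict
  induction s, hs using MeasurableSpace.induction_on_inter generateFrom_prod.symm isPiSystem_prod with
  | empty => simp
  | basic s hs =>
    obtain ⟨A, hA, B, hB, rfl⟩ := hs
    exact hrect A hA B hB
  | compl s hs ih =>
    have h1 := integral_add_compl hs hr
    have h2 := hrect univ MeasurableSet.univ univ MeasurableSet.univ
    rw [univ_prod_univ, setIntegral_univ] at h2
    rw [ih, h2] at h1
    linarith
  | iUnion f hd hm ih =>
    rw [integral_iUnion hm hd hr.integrableOn]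
    simp [ih]

theorem integrable_eval_sub_mul {N : ℕ} (κ : Cper N) {e : Vec N → ℝ}
    (he : Integrable e (volOn (unitCube N))) (y : Vec N) :
    Integrable (fun s => (κ : Vec N →ᵇ ℝ) (y - s) * e s) (volOn (unitCube N)) := by
  refine he.bdd_mul (c := ‖κ‖) (Continuous.aestronglyMeasurable ?_)
    (ae_of_all _ fun s => abs_eval_le κ _)
  have := (κ : Vec N →ᵇ ℝ).continuous
  fun_prop

/-- Convolution over the cell of a continuous periodic function with an integrable function. -/
def cellConv {N : ℕ} (κ : Cper N) {e : Vec N → ℝ} (he : Integrable e (volOn (unitCube N))) :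
    Cper N :=
  Cper.mk (fun y => ∫ s in unitCube N, (κ : Vec N →ᵇ ℝ) (y - s) * e s)
    (by
      have hκ := (κ : Vec N →ᵇ ℝ).continuous
      refine continuous_of_dominated (bound := fun s => ‖κ‖ * ‖e s‖)
        (fun y => (integrable_eval_sub_mul κ he y).1) (fun y => ae_of_all _ fun s => ?_)
        (he.norm.const_mul _) (ae_of_all _ fun s => by fun_prop)
      rw [norm_mul]
      exact mul_le_mul_of_nonneg_right (abs_eval_le κ _) (norm_nonneg _))
    (by
      intro k y
      dsimp only
      congr! 3 with s
      have := κ.2 k (y - s)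
      rw [← this]
      congr 1
      abel)

theorem cellConv_apply {N : ℕ} (κ : Cper N) {e : Vec N → ℝ}
    (he : Integrable e (volOn (unitCube N))) (y : Vec N) :
    (cellConv κ he : Vec N →ᵇ ℝ) y = ∫ s in unitCube N, (κ : Vec N →ᵇ ℝ) (y - s) * e s := rfl

theorem integrable_kernel_mul {N : ℕ} {k : Vec N × Vec N → ℝ} (hk : Continuous k) {e : Vec N → ℝ}
    (he : Integrable e (volOn (unitCube N))) :
    Integrable (fun p : Vec N × Vec N => k p * e p.2)
      ((volOn (unitCube N)).prod (volOn (unitCube N))) := by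
  obtain ⟨C, hC⟩ := ((isCompact_Icc (a := (0 : Vec N)) (b := 1)).prod
    (isCompact_Icc (a := (0 : Vec N)) (b := 1))).exists_bound_of_continuousOn hk.continuousOn
  refine (he.comp_snd _).bdd_mul (c := C) hk.aestronglyMeasurable ?_
  rw [Measure.prod_restrict]
  refine (ae_restrict_iff' (measurableSet_unitCube.prod measurableSet_unitCube)).2
    (ae_of_all _ fun p hp => hC p ?_)
  exact Set.prod_mono (closure_unitCube (N := N) ▸ subset_closure)
    (closure_unitCube (N := N) ▸ subset_closure) hp

/-- As for mollification, the convolution passes to translates of the test function. Here it also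
turns a merely integrable field into a continuous one. -/
theorem cellConv_mem_divFreeCper {N : ℕ} (κ : Cper N) {e : Fin N → Vec N → ℝ}
    (he : ∀ i, Integrable (e i) (volOn (unitCube N))) (hd : IsDivFree (fun _ => 1) e) :
    (fun i => cellConv κ (he i)) ∈ divFreeCper N := by
  intro ψ hψ hψp
  have hκ := (κ : Vec N →ᵇ ℝ).continuous
  have hp : ∀ i, Continuous (partialD i ψ) := fun i => (hψ.partialD i).continuous
  have key : ∀ i, ∫ y in unitCube N, (cellConv κ (he i) : Vec N →ᵇ ℝ) y * partialD i ψ y =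
      ∫ y in unitCube N, (κ : Vec N →ᵇ ℝ) y *
        ∫ s in unitCube N, e i s * partialD i (fun z => ψ (z + y)) s := by
    intro i
    have hpi := hp i
    simp only [cellConv_apply, ← integral_mul_const, ← integral_const_mul]
    rw [integral_integral_swap, integral_integral_swap (f := fun y s =>
      (κ : Vec N →ᵇ ℝ) y * (e i s * partialD i (fun z => ψ (z + y)) s))]
    · refine integral_congr_ae (ae_of_all _ fun s => ?_)
      dsimp only
      have hper : IsYPeriodic fun y => (κ : Vec N →ᵇ ℝ) (y - s) * e i s * partialD i ψ y := by
        intro k y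
        have h1 := (IsYPeriodic.comp_add κ.2 (-s)) k y
        simp only [← sub_eq_add_neg] at h1
        simp only [h1, (hψp.partialD i) k y]
      rw [← setIntegral_unitCube_add hper s]
      refine integral_congr_ae (ae_of_all _ fun y => ?_)
      simp only [partialD, add_sub_cancel_right, fderiv_comp_add_right, mul_assoc, add_comm s y]
    · refine (integrable_kernel_mul (k := fun p => (κ : Vec N →ᵇ ℝ) p.1 * partialD i ψ (p.2 + p.1))
        (by fun_prop) (he i)).congr (ae_of_all _ fun p => ?_)
      simp only [Function.uncurry, partialD, fderiv_comp_add_right]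
      ring
    · refine (integrable_kernel_mul (k := fun p => (κ : Vec N →ᵇ ℝ) (p.1 - p.2) * partialD i ψ p.1)
        (by fun_prop) (he i)).congr (ae_of_all _ fun p => ?_)
      simp only [Function.uncurry]
      ring
  simp only [key, one_mul]
  rw [← integral_finsetSum]
  · simp only [← Finset.mul_sum]
    refine integral_eq_zero_of_ae (ae_of_all _ fun y => ?_)
    have := hd (fun z => ψ (z + y)) (hψ.comp (by fun_prop)) (hψp.comp_add y)
    simp only [one_mul] at this
    simp [this]
  · intro i _
    have hpi := hp i
    have h1 := (integrable_kernel_mul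
      (k := fun p => (κ : Vec N →ᵇ ℝ) p.1 * partialD i ψ (p.2 + p.1))
      (by fun_prop) (he i)).integral_prod_left
    refine h1.congr (ae_of_all _ fun y => ?_)
    dsimp only
    rw [← integral_const_mul]
    refine integral_congr_ae (ae_of_all _ fun s => ?_)
    simp only [partialD, fderiv_comp_add_right]
    ring

/-- The reflection `y ↦ ψ(-y)`. -/
def Cper.reflect {N : ℕ} (ψ : Cper N) : Cper N :=
  Cper.mk (fun y => (ψ : Vec N →ᵇ ℝ) (-y))
    ((ψ : Vec N →ᵇ ℝ).continuous.comp continuous_neg) (IsYPeriodic.comp_neg ψ.2)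

theorem Cper.reflect_apply {N : ℕ} (ψ : Cper N) (y : Vec N) :
    ((Cper.reflect ψ) : Vec N →ᵇ ℝ) y = (ψ : Vec N →ᵇ ℝ) (-y) := rfl

/-- Convolution with the reflected kernel is the adjoint of convolution with `ψ`. -/
theorem integral_mul_cellConv_reflect {N : ℕ} (ψ g : Cper N) {e : Vec N → ℝ}
    (he : Integrable e (volOn (unitCube N)))
    (hg : Integrable (g : Vec N →ᵇ ℝ) (volOn (unitCube N))) :
    ∫ y in unitCube N, e y * (cellConv (Cper.reflect ψ) hg : Vec N →ᵇ ℝ) y =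
      ∫ t in unitCube N, (g : Vec N →ᵇ ℝ) t * (cellConv ψ he : Vec N →ᵇ ℝ) t := by
  have hψ := (ψ : Vec N →ᵇ ℝ).continuous
  have hgc := (g : Vec N →ᵇ ℝ).continuous
  simp only [cellConv_apply, ← integral_const_mul]
  rw [integral_integral_swap]
  · refine integral_congr_ae (ae_of_all _ fun t => integral_congr_ae (ae_of_all _ fun y => ?_))
    simp only [Cper.reflect_apply, neg_sub]
    ring
  · have h1 := (integrable_kernel_mul
      (k := fun p => (ψ : Vec N →ᵇ ℝ) (p.1 - p.2) * (g : Vec N →ᵇ ℝ) p.1)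
      (by fun_prop) he).swap
    refine h1.congr (ae_of_all _ fun p => ?_)
    simp only [Function.uncurry, Function.comp, Prod.swap, Cper.reflect_apply, neg_sub]
    ring

/-- Let `g` be the convolution of `e` with the reflected `ψ`. Convolving `g` with `ψ` gives an
admissible test field, and by adjointness its pairing with `e` is `∑ ∫ g_i²`. Hence `g = 0`, and
`g_i(0) = ∫ ψ e_i`. -/
theorem ae_eq_zero_of_divFree_of_orthogonal {N : ℕ} {e : Fin N → Vec N → ℝ}
    (he : ∀ i, Integrable (e i) (volOn (unitCube N))) (hd : IsDivFree (fun _ => 1) e)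
    (ho : ∀ f ∈ divFreeCper N, ∑ i, ∫ y in unitCube N, e i y * (f i : Vec N →ᵇ ℝ) y = 0)
    (i : Fin N) : ∀ᵐ y ∂(volOn (unitCube N)), e i y = 0 := by
  refine ae_eq_zero_of_forall_integral_Cper_mul (he i) fun ψ => ?_
  set g : Fin N → Cper N := fun i => cellConv (Cper.reflect ψ) (he i)
  have hgi : ∀ i, Integrable (g i : Vec N →ᵇ ℝ) (volOn (unitCube N)) := fun i =>
    integrableOn_cell_of_continuous (g i : Vec N →ᵇ ℝ).continuous
  have h1 := ho _ (cellConv_mem_divFreeCper (Cper.reflect (Cper.reflect ψ)) hgi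
    (cellConv_mem_divFreeCper (Cper.reflect ψ) he hd))
  simp only [integral_mul_cellConv_reflect (Cper.reflect ψ) _ (he _) (hgi _)] at h1
  rw [Finset.sum_eq_zero_iff_of_nonneg fun i _ => integral_nonneg fun y => mul_self_nonneg _] at h1
  have h2 := h1 i (Finset.mem_univ i)
  have hc := (g i : Vec N →ᵇ ℝ).continuous
  rw [integral_eq_zero_iff_of_nonneg (fun y => mul_self_nonneg _)
    (integrableOn_cell_of_continuous (hc.mul hc))] at h2
  have h3 := IsYPeriodic.eq_zero_of_ae (g i).2 hc (h2.mono fun y hy => mul_self_eq_zero.1 hy) 0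
  simpa only [g, cellConv_apply, Cper.reflect_apply, zero_sub, neg_neg] using h3

theorem restrict_prod_le {N : ℕ} (Ω A : Set (Vec N)) :
    ((volOn Ω).restrict A).prod (volOn (unitCube N)) ≤ volProd Ω := by
  have h := Measure.prod_restrict (μ := volOn Ω) (ν := volOn (unitCube N)) A univ
  rw [Measure.restrict_univ] at h
  rw [h]
  exact Measure.restrict_le_self

theorem isDivFree_setIntegral {N : ℕ} {Ω A : Set (Vec N)} [IsFiniteMeasure (volOn Ω)]
    {r : Fin N → L2Y Ω} (hr : r ∈ divFreeL2 Ω (fun _ _ => 1)) :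
    IsDivFree (fun _ => 1) fun i y => ∫ x in A, r i (x, y) ∂(volOn Ω) := by
  intro ψ hψ hψp
  have hi : ∀ i, Integrable (fun p => r i p * partialD i ψ p.2)
      (((volOn Ω).restrict A).prod (volOn (unitCube N))) := fun i =>
    ((Lp.memLp (r i)).integrable_mul
      ((memLp_partialD i hψ).comp_snd (volOn Ω))).mono_measure (restrict_prod_le Ω A)
  have key : ∀ i, ∫ y in unitCube N, (∫ x in A, r i (x, y) ∂(volOn Ω)) * partialD i ψ y =
      ∫ x in A, (∫ y in unitCube N, r i (x, y) * partialD i ψ y) ∂(volOn Ω) := by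
    intro i
    simp only [← integral_mul_const]
    exact (integral_integral_swap (f := fun x y => r i (x, y) * partialD i ψ y) (hi i)).symm
  simp only [key, one_mul]
  rw [← integral_finsetSum _ fun i _ => (hi i).integral_prod_left]
  refine integral_eq_zero_of_ae (ae_restrict_of_ae ?_)
  filter_upwards [mem_divFreeL2.1 hr] with x hx
  simpa using hx ψ hψ hψp

/-- The field `1_A(x) f(y)` tests the integral over `A` of the `x`-slices against `f`, which passes
orthogonality on `Ω × Y` down to the cell. -/
theorem exists_indicator_mem_divFree {N : ℕ} {Ω A : Set (Vec N)} [IsFiniteMeasure (volOn Ω)]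
    (hA : MeasurableSet A) {f : Fin N → Cper N} (hf : f ∈ divFreeCper N) :
    ∃ v ∈ divFree Ω (fun _ _ => 1), ∀ (i : Fin N) (u : L2Y Ω),
      ∫ p, u p * toL2Y Ω (v i) p ∂(volProd Ω) =
        ∫ y in unitCube N, (∫ x in A, u (x, y) ∂(volOn Ω)) * (f i : Vec N →ᵇ ℝ) y := by
  have hm : ∀ i, MemLp (A.indicator fun _ => f i) 2 (volOn Ω) := fun i =>
    memLp_indicator_const 2 hA (f i) (Or.inr (measure_ne_top _ _))
  refine ⟨fun i => (hm i).toLp, ?_, fun i u => ?_⟩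
  · refine (mem_divFree_iff fun i => (hm i).coeFn_toLp).2 (ae_of_all _ fun x => ?_)
    by_cases hx : x ∈ A
    · simp only [indicator_of_mem hx]
      exact hf
    · simp only [indicator_of_notMem hx]
      exact (divFreeCper N).zero_mem
  · have hae := toL2Y_ae_eq (hm i).coeFn_toLp
    rw [integral_prod_symm (fun p => u p * toL2Y Ω (hm i).toLp p) ((Lp.memLp u).integrable_mul (Lp.memLp _))]
    have hae₁ : ∀ᵐ q ∂((volOn (unitCube N)).prod (volOn Ω)), toL2Y Ω (hm i).toLp q.swap =
        ((A.indicator (fun _ => f i) q.2 : Cper N) : Vec N →ᵇ ℝ) q.1 :=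
      (Measure.measurePreserving_swap (μ := volOn (unitCube N))
        (ν := volOn Ω)).quasiMeasurePreserving.ae hae
    have hae' := Measure.ae_ae_of_ae_prod hae₁
    refine integral_congr_ae ?_
    filter_upwards [hae'] with y hy
    rw [← integral_mul_const, ← integral_indicator hA]
    refine integral_congr_ae ?_
    filter_upwards [hy] with x hx
    rw [Prod.swap_prod_mk] at hx
    rw [hx]
    by_cases hxA : x ∈ A
    · simp only [indicator_of_mem hxA]
    · simp only [indicator_of_notMem hxA]
      exact mul_zero _

theorem eq_zero_of_orthogonal_divFree {N : ℕ} {Ω : Set (Vec N)} [IsFiniteMeasure (volOn Ω)]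
    {r : Fin N → L2Y Ω} (hr : r ∈ divFreeL2 Ω (fun _ _ => 1))
    (ho : ∀ v ∈ divFree Ω (fun _ _ => 1), ∑ i, ∫ p, r i p * toL2Y Ω (v i) p ∂(volProd Ω) = 0) :
    r = 0 := by
  ext1 i
  have hi : ∀ i, Integrable (r i) (volProd Ω) := fun i => (Lp.memLp (r i)).integrable one_le_two
  refine Lp.ext (EventuallyEq.trans ?_ (Lp.coeFn_zero ℝ 2 (volProd Ω)).symm)
  refine ae_eq_zero_of_forall_setIntegral_section (hi i) fun A hA => ?_
  refine ae_eq_zero_of_divFree_of_orthogonal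
    (e := fun i y => ∫ x in A, r i (x, y) ∂(volOn Ω))
    (fun i => ((hi i).mono_measure (restrict_prod_le Ω A)).integral_prod_right)
    (isDivFree_setIntegral hr) (fun f hf => ?_) i
  obtain ⟨v, hv, h⟩ := exists_indicator_mem_divFree (Ω := Ω) hA hf
  simp only [← h]
  exact ho v hv

theorem divFreeL2_one_subset_closure {N : ℕ} {Ω : Set (Vec N)} [IsFiniteMeasure (volOn Ω)] :
    (divFreeL2 Ω (fun _ _ => 1) : Set (Fin N → L2Y Ω)) ⊆
      closure ((fun v i => toL2Y Ω (v i)) ''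
        (divFree Ω (fun _ _ => 1) : Set (Fin N → L2Cper Ω))) := by
  intro w hw
  -- The product carries the supremum norm; the equivalent `ℓ²` norm makes orthogonal projection
  -- available.
  set Φ : PiLp 2 (fun _ : Fin N => L2Y Ω) ≃L[ℝ] (Fin N → L2Y Ω) :=
    PiLp.continuousLinearEquiv 2 ℝ (fun _ : Fin N => L2Y Ω)
  set S : Submodule ℝ (PiLp 2 (fun _ : Fin N => L2Y Ω)) :=
    (divFree Ω (fun _ _ => 1)).map
      (Φ.symm.toLinearEquiv.toLinearMap ∘ₗ (toL2Y Ω).compLeft (Fin N))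
  have hcl : S.topologicalClosure ≤
      (divFreeL2 Ω (fun _ _ => 1)).comap Φ.toLinearEquiv.toLinearMap := by
    refine Submodule.topologicalClosure_minimal _ ?_
      ((isClosed_divFreeL2 Ω _).preimage Φ.continuous)
    rintro _ ⟨v, hv, rfl⟩
    exact hv
  have hcomplete : CompleteSpace S.topologicalClosure :=
    S.isClosed_topologicalClosure.completeSpace_coe
  obtain ⟨p, hp, r, hr, hpr⟩ :=
    S.topologicalClosure.exists_add_mem_mem_orthogonal (Φ.symm w)
  -- The projection stays in the closed constraint space, so the residual is divergence free as well
  -- as orthogonal to the continuous fields.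
  have hrw : Φ r ∈ divFreeL2 Ω (fun _ _ => 1) := by
    have : Φ r = w - Φ p := by
      rw [eq_sub_iff_add_eq, add_comm, ← map_add, ← hpr, Φ.apply_symm_apply]
    rw [this]
    exact Submodule.sub_mem _ hw (hcl hp)
  have hr0 : Φ r = 0 := by
    refine eq_zero_of_orthogonal_divFree hrw fun v hv => ?_
    have h1 := (Submodule.mem_orthogonal _ _).1 hr
      (Φ.symm fun i => toL2Y Ω (v i)) (S.le_topologicalClosure ⟨v, hv, rfl⟩)
    rw [PiLp.inner_apply] at h1
    rw [← h1]
    refine Finset.sum_congr rfl fun i _ => ?_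
    rw [L2.inner_def]
    rfl
  have hr0' : r = 0 := Φ.map_eq_zero_iff.1 hr0
  rw [hr0', add_zero] at hpr
  have hmem : Φ.symm w ∈ closure (S : Set (PiLp 2 (fun _ : Fin N => L2Y Ω))) := by
    rw [hpr]; exact hp
  have := map_mem_closure Φ.continuous hmem (t := (fun v i => toL2Y Ω (v i)) ''
        (divFree Ω (fun _ _ => 1) : Set (Fin N → L2Cper Ω))) (by
    rintro _ ⟨v, hv, rfl⟩
    exact ⟨v, hv, rfl⟩)
  rwa [Φ.apply_symm_apply] at this

theorem divFreeL2_subset_closure {N : ℕ} {Ω : Set (Vec N)} [IsFiniteMeasure (volOn Ω)]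
    (hΩ : IsOpen Ω) {ζ ξ : Fin N → Vec N → ℝ} (hζ : ∀ i, MemLp (ζ i) ⊤ (volOn Ω))
    (hξ : ∀ i, MemLp (ξ i) ⊤ (volOn Ω)) (hξs : ∀ i, ContDiffOn ℝ ∞ (ξ i) Ω)
    (h : ∀ᵐ x ∂(volOn Ω), ∀ i, ξ i x * ζ i x = 1) :
    (divFreeL2 Ω ζ : Set (Fin N → L2Y Ω)) ⊆
      closure ((divFreeL2 Ω ζ : Set (Fin N → L2Y Ω)) ∩
        smoothElements Ω (LinearMap.id : L2Y Ω →ₗ[ℝ] L2Y Ω)) := by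
  have hζ' : ∀ i, MemLp (fun p : Vec N × Vec N => ζ i p.1) ⊤ (volProd Ω) := fun i =>
    (hζ i).comp_fst _
  have hξ' : ∀ i, MemLp (fun p : Vec N × Vec N => ξ i p.1) ⊤ (volProd Ω) := fun i =>
    (hξ i).comp_fst _
  have hsub : (fun v i => toL2Y Ω (v i)) '' (divFree Ω ζ : Set (Fin N → L2Cper Ω)) ⊆
      closure ((divFreeL2 Ω ζ : Set (Fin N → L2Y Ω)) ∩
        smoothElements Ω (LinearMap.id : L2Y Ω →ₗ[ℝ] L2Y Ω)) := by
    rintro _ ⟨v, hv, rfl⟩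
    refine map_mem_closure (f := fun v i => toL2Y Ω (v i))
      (continuous_pi fun i => (toL2YL Ω).continuous.comp (continuous_apply i))
      (divFree_subset_closure hΩ hζ hξ hξs h hv) ?_
    rintro u ⟨h1, h2⟩
    exact ⟨h1, h2⟩
  -- Test fields approximate the fields from `X` even in the stronger norm of `X`, so only density
  -- of the latter in `L²(Ω × Y)^N` remains.
  refine Subset.trans ?_ (closure_minimal hsub isClosed_closure)
  intro w hw
  have hw1 : (fun i => mulLp ℝ (hζ' i) (w i)) ∈ divFreeL2 Ω (fun _ _ => 1) :=
    mulLp_mem_divFreeL2 hζ' (ae_of_all _ fun x i => one_mul _) hw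
  have hT : Continuous fun (u : Fin N → L2Y Ω) i => mulLp ℝ (hξ' i) (u i) :=
    continuous_pi fun i => (mulLp ℝ (hξ' i)).continuous.comp (continuous_apply i)
  have hw' : (fun i => mulLp ℝ (hξ' i) (mulLp ℝ (hζ' i) (w i))) = w :=
    funext fun i => mulLp_mulLp (hζ' i) (hξ' i)
      (Measure.quasiMeasurePreserving_fst.ae (h.mono fun x hx => hx i)) (w i)
  rw [← hw']
  refine map_mem_closure hT (divFreeL2_one_subset_closure hw1) ?_
  rintro _ ⟨v, hv, rfl⟩
  refine ⟨fun i => mulLp (Cper N) (hξ i) (v i), mulLp_mem_divFree hξ ?_ hv,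
    funext fun i => toL2Y_mulLp (hξ i) (hξ' i) (v i)⟩
  filter_upwards [h] with x hx i
  rw [mul_comm, hx]

/-! ### Conclusion for the rectangle. -/

theorem isOpen_box (a b : Vec 2) : IsOpen (box a b) :=
  isOpen_set_pi finite_univ fun _ _ => isOpen_Ioo

/-- When `a₂ > 0` this bounds `1/ζ_i` on the box, as the change of weights requires. -/
theorem min_le_zetaEx {a b : Vec 2} {x : Vec 2} (hx : x ∈ box a b) (i : Fin 2) :
    min 1 (2 * a 1) ≤ zetaEx i x := by
  fin_cases i
  · simp [zetaEx]
  · have : a 1 < x 1 := (hx 1 (mem_univ _)).1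
    simp [zetaEx, this.le]

theorem contDiff_zetaEx (i : Fin 2) : ContDiff ℝ ∞ (zetaEx i) := by
  fin_cases i
  · exact contDiff_const
  · exact contDiff_const.mul (contDiff_apply ℝ ℝ 1)

theorem densityCondition_of_closure {a b : Vec 2} (ha : ∀ i, 0 < a i) {E : Type}
    [NormedAddCommGroup E] [NormedSpace ℝ E] [CompleteSpace E] {j : E →ₗ[ℝ] L2Y (box a b)}
    {Z : Submodule ℝ (Fin 2 → E)}
    (hZ : ∀ v ∈ Z, (fun i => j (v i)) ∈ divFreeL2 (box a b) zetaEx)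
    (hc : IsClosed (Z : Set (Fin 2 → E)))
    (hd : (Z : Set (Fin 2 → E)) ⊆ closure ((Z : Set (Fin 2 → E)) ∩ smoothElements (box a b) j)) :
    DensityCondition (box a b) alphaEx j Z :=
  ⟨hc.isComplete, hd, fun v hv _ hφ => weakTendsto_zero_of_divFree ha (fun i => (hφ i).1)
    ((ae_isDivFree_iff fun i => (hφ i).2).1 (hZ v hv))⟩

theorem densityConditions {a b : Vec 2} (ha : ∀ i, 0 < a i) :
    DensityCondition (box a b) alphaEx (toL2Y (box a b)) (divFree (box a b) zetaEx) ∧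
    DensityCondition (box a b) alphaEx LinearMap.id (divFreeL2 (box a b) zetaEx) := by
  have := isFiniteMeasure_box a b
  have hm : (0 : ℝ) < min 1 (2 * a 1) := lt_min one_pos (by linarith [ha 1])
  have hpos : ∀ i, ∀ x ∈ box a b, 0 < zetaEx i x := fun i x hx => hm.trans_le (min_le_zetaEx hx i)
  have hξs : ∀ i, ContDiffOn ℝ ∞ (fun x => (zetaEx i x)⁻¹) (box a b) := fun i =>
    (contDiff_zetaEx i).contDiffOn.inv fun x hx => (hpos i x hx).ne'
  have hξ : ∀ i, MemLp (fun x => (zetaEx i x)⁻¹) ⊤ (volOn (box a b)) := fun i => by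
    refine memLp_top_of_bound (C := (min 1 (2 * a 1))⁻¹)
      ((hξs i).continuousOn.aestronglyMeasurable (measurableSet_box a b)) ?_
    filter_upwards [ae_restrict_mem (measurableSet_box a b)] with x hx
    rw [norm_inv, Real.norm_of_nonneg (hpos i x hx).le]
    exact inv_anti₀ hm (min_le_zetaEx hx i)
  have h : ∀ᵐ x ∂(volOn (box a b)), ∀ i, (zetaEx i x)⁻¹ * zetaEx i x = 1 := by
    filter_upwards [ae_restrict_mem (measurableSet_box a b)] with x hx i
    exact inv_mul_cancel₀ (hpos i x hx).ne'
  exact ⟨densityCondition_of_closure ha (fun v hv => hv) (isClosed_divFree _ _)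
      (divFree_subset_closure (isOpen_box a b) (memLp_zetaEx ha) hξ hξs h),
    densityCondition_of_closure ha (fun v hv => hv) (isClosed_divFreeL2 _ _)
      (divFreeL2_subset_closure (isOpen_box a b) (memLp_zetaEx ha) hξ hξs h)⟩

theorem isTypeH_alphaEx {a b : Vec 2} (ha : ∀ i, 0 < a i) : IsTypeH (box a b) alphaEx zetaEx where
  bijective := bijective_alphaEx
  differentiable h _ hx := (hasFDerivAt_alphaEx h (pos_of_mem_box ha hx 1)).differentiableAt
  complete := inferInstance
  test_subset := fun _ => exists_toL2Y_eq_test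
  subset_L2 := toL2Y_injective _
  compatible := isStronglyTwoScaleCompatible_alphaEx ha
  gradient := ⟨_, gradientCondition_alphaEx ha⟩
  density := ⟨_, (densityConditions ha).1⟩

end LambdaScale

end

theorem mainTheorem3 (a b : LambdaScale.Vec 2) (ha : ∀ i, 0 < a i) (hab : ∀ i, a i < b i) :
    LambdaScale.IsTypeH (LambdaScale.box a b) LambdaScale.alphaEx LambdaScale.zetaEx ∧
    LambdaScale.GradientCondition (LambdaScale.box a b) LambdaScale.alphaEx LambdaScale.zetaEx
      (fun h _ => 1 / (h : ℝ)) ∧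
    LambdaScale.DensityCondition (LambdaScale.box a b) LambdaScale.alphaEx
      (LambdaScale.toL2Y (LambdaScale.box a b))
      (LambdaScale.divFree (LambdaScale.box a b) LambdaScale.zetaEx) ∧
    LambdaScale.DensityCondition (LambdaScale.box a b) LambdaScale.alphaEx LinearMap.id
      (LambdaScale.divFreeL2 (LambdaScale.box a b) LambdaScale.zetaEx) :=
  ⟨LambdaScale.isTypeH_alphaEx ha, LambdaScale.gradientCondition_alphaEx ha,
    LambdaScale.densityConditions ha⟩
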